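/- Let $\beta,\gamma\in\mathbb R$ and let $a,b:\mathbb R\to\mathbb R$ be smooth functions decaying, with all derivatives, faster than any power of $1+|y|$. Put $\phi(s,y)=-\beta a(y)^2\ln s+b(y)$ and $V_0=a\,e^{i\phi}$ for $s>0$. For an integer $k\ge 1$ let $\mathcal S_k$ be the set of finite sums $\sum_{k'\ge k,\,j\ge 0}c_{k'j}(y)\,e^{i\phi}\,\ln^j s\,/\,s^{k'}$ ($s>0$), whose complex-valued coefficients $c_{k'j}$ are smooth and decay, with all derivatives, faster than any power of $1+|y|$. Let $$\Psi(V)=i\partial_sV-\tfrac{\beta}{s}|V|^2V-\tfrac{\gamma}{s^2}|V|^4V+\tfrac1{s^2}\partial_y^2V ,$$ let $\Psi'(V)W=i\partial_sW-\tfrac{\beta}{s}\big(2|V|^2W+V^2\overline W\big)-\tfrac{\gamma}{s^2}\big(3|V|^4W+2|V|^2V^2\overline W\big)+\tfrac1{s^2}\partial_y^2W$ be its (real-linear, not complex-linear) linearization, and let $L_0W=\Psi'(V_0)W-s^{-2}\partial_y^2W$. Then: 1. For all integers $k\ge1$, $j\ge0$ and every $Y:\mathbb R\to\mathbb C$, with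 $Z=\frac1{k^2}\big((-\beta a^2+ik)Y+\beta a^2\overline Y\big)$, $$L_0\Big(\frac{e^{i\phi}\ln^js}{s^k}Z\Big)=\frac{e^{i\phi}\ln^js}{s^{k+1}}Y+ij\,\frac{e^{i\phi}\ln^{j-1}s}{s^{k+1}}Z+\frac{e^{i\phi}\ln^js}{s^{k+2}}\big(-3\gamma a^4Z-2\gamma a^4\overline Z\big)$$ (the middle term being absent for $j=0$). 2. If $k\ge1$ and $\psi_{k+1}\in\mathcal S_{k+1}$, there are $\phi_k\in\mathcal S_k$ and $\psi_{k+2}\in\mathcal S_{k+2}$ with $L_0\phi_k=\psi_{k+1}+\psi_{k+2}$. 3. The same holds with $L_0$ replaced by $\Psi'(V)$, for every $V$ with $V-V_0\in\mathcal S_1$. 4. There is a sequence $V_0,V_1,V_2,\dots$ starting with the given $V_0$ such that, for all $n\ge0$, $V_n-V_0\in\mathcal S_1$, $V_{n+1}-V_n\in\mathcal S_{n+1}$ and $\Psi(V_n)\in\mathcal S_{n+2}$. 5. Let $N\ge1$ and let $V_N$ be any function with $V_N-V_0\in\mathcal S_1$ and $\Psi(V_N)\in\mathcal S_{N+2}$.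 Put $v_N(t,x)=t^{-1/2}e^{ix^2/4t}\,V_N(t,x/t)$. Then there are $T\ge1$, $C\ge0$ and a classical solution $v$ (with $v,\partial_tv,\partial_xv,\partial_x^2v$ continuous) of $$i\partial_tv+\partial_x^2v-\beta|v|^2v-\gamma|v|^4v=0\qquad\text{on }(T,\infty)\times\mathbb R$$ such that for all $t>T$ $$\|(v-v_N)(t,\cdot)\|_{L^2}+\|\partial_x(v-v_N)(t,\cdot)\|_{L^2}+\|\partial_t(v-v_N)(t,\cdot)\|_{L^2}\le C\,t^{-N}.$$ -/

import Mathlib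

open MeasureTheory Set
open scoped SchwartzMap ComplexConjugate

noncomputable section

namespace NLS

/-- The phase `φ(s,y) = -β a(y)² ln s + b(y)`. -/
def phase (β : ℝ) (a b : 𝓢(ℝ, ℝ)) (s y : ℝ) : ℝ :=
  -β * a y ^ 2 * Real.log s + b y

/-- The oscillating factor `e^{iφ(s,y)}`. -/
def osc (β : ℝ) (a b : 𝓢(ℝ, ℝ)) (s y : ℝ) : ℂ :=
  Complex.exp (Complex.I * (phase β a b s y : ℂ))

/-- The leading profile `V₀ = a e^{iφ}`. -/
def V0 (β : ℝ) (a b : 𝓢(ℝ, ℝ)) (s y : ℝ) : ℂ :=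
  (a y : ℂ) * osc β a b s y

/-- Cubic nonlinearity `G₁(g) = |g|² g`. -/
def G₁ (g : ℂ) : ℂ := (‖g‖ : ℂ) ^ 2 * g

/-- Quintic nonlinearity `G₂(g) = |g|⁴ g`. -/
def G₂ (g : ℂ) : ℂ := (‖g‖ : ℂ) ^ 4 * g

/-- `G₁'(g) w = 2|g|² w + g² w̄`, the (real-linear) derivative of `G₁`. -/
def dG₁ (g w : ℂ) : ℂ := 2 * (‖g‖ : ℂ) ^ 2 * w + g ^ 2 * conj w

/-- `G₂'(g) w = 3|g|⁴ w + 2|g|² g² w̄`, the (real-linear) derivative of `G₂`. -/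
def dG₂ (g w : ℂ) : ℂ := 3 * (‖g‖ : ℂ) ^ 4 * w + 2 * (‖g‖ : ℂ) ^ 2 * g ^ 2 * conj w

/-- The operator `Ψ(V) = i ∂_s V - β s⁻¹ |V|² V - γ s⁻² |V|⁴ V + s⁻² ∂_y² V`. -/
def Psi (β γ : ℝ) (V : ℝ → ℝ → ℂ) (s y : ℝ) : ℂ :=
  Complex.I * deriv (fun σ => V σ y) s
    - (β / s : ℝ) * G₁ (V s y) - (γ / s ^ 2 : ℝ) * G₂ (V s y)
    + (1 / s ^ 2 : ℝ) * iteratedDeriv 2 (fun η => V s η) y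

/-- The linearization at `V` of the ordinary differential operator
`L(g) = i g' - β s⁻¹ |g|² g - γ s⁻² |g|⁴ g`, applied to `W`. -/
def dL (β γ : ℝ) (V W : ℝ → ℝ → ℂ) (s y : ℝ) : ℂ :=
  Complex.I * deriv (fun σ => W σ y) s
    - (β / s : ℝ) * dG₁ (V s y) (W s y) - (γ / s ^ 2 : ℝ) * dG₂ (V s y) (W s y)

/-- `L₀ = L'(V₀)`. -/
def L0 (β γ : ℝ) (a b : 𝓢(ℝ, ℝ)) (W : ℝ → ℝ → ℂ) (s y : ℝ) : ℂ :=
  dL β γ (V0 β a b) W s y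

/-- The linearization `Ψ'(V) W` of `Ψ` at `V`. -/
def dPsi (β γ : ℝ) (V W : ℝ → ℝ → ℂ) (s y : ℝ) : ℂ :=
  dL β γ V W s y + (1 / s ^ 2 : ℝ) * iteratedDeriv 2 (fun η => W s η) y

/-- Membership in `𝒮_k`: for `s > 0`, `W` is a finite sum of terms
`c_{k'j}(y) e^{iφ} (ln s)^j / s^{k'}` with `k' ≥ k`, `j ≥ 0`, whose coefficients are smooth and
decay, with all their derivatives, faster than any power of `1 + |y|`. -/
def InS (β : ℝ) (a b : 𝓢(ℝ, ℝ)) (k : ℕ) (W : ℝ → ℝ → ℂ) : Prop :=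
  ∃ (K J : ℕ) (c : ℕ → ℕ → 𝓢(ℝ, ℂ)), ∀ s : ℝ, 0 < s → ∀ y : ℝ,
    W s y = ∑ k' ∈ Finset.Icc k K, ∑ j ∈ Finset.range J,
      c k' j y * (osc β a b s y * (Real.log s : ℂ) ^ j / (s : ℂ) ^ k')

/-- The function `v(t,x) = t^{-1/2} e^{ix²/4t} V(t, x/t)` with profile `V`. -/
def ofProfile (V : ℝ → ℝ → ℂ) (t x : ℝ) : ℂ :=
  ((t ^ (-(1 / 2) : ℝ) : ℝ) : ℂ) * Complex.exp (Complex.I * ((x ^ 2 / (4 * t) : ℝ) : ℂ))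
    * V t (x / t)

/-- `v` is a classical solution of `i ∂_t v + ∂_x² v - β |v|² v - γ |v|⁴ v = 0` on
`(T, ∞) × ℝ`: the derivatives `∂_t v`, `∂_x v`, `∂_x² v` exist and, like `v`, are jointly
continuous, and the equation holds at every point. -/
structure IsClassicalSolution (β γ T : ℝ) (v : ℝ → ℝ → ℂ) : Prop where
  diff_t : ∀ t, T < t → ∀ x, DifferentiableAt ℝ (fun τ => v τ x) t
  diff_x : ∀ t, T < t → ContDiff ℝ 2 (v t)
  cont : ContinuousOn (fun p : ℝ × ℝ => v p.1 p.2) (Ioi T ×ˢ univ)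
  cont_t : ContinuousOn (fun p : ℝ × ℝ => deriv (fun τ => v τ p.2) p.1) (Ioi T ×ˢ univ)
  cont_x : ContinuousOn (fun p : ℝ × ℝ => deriv (v p.1) p.2) (Ioi T ×ˢ univ)
  cont_xx : ContinuousOn (fun p : ℝ × ℝ => iteratedDeriv 2 (v p.1) p.2) (Ioi T ×ˢ univ)
  eqn : ∀ t, T < t → ∀ x,
    Complex.I * deriv (fun τ => v τ x) t + iteratedDeriv 2 (v t) x
      - (β : ℂ) * G₁ (v t x) - (γ : ℂ) * G₂ (v t x) = 0

/-- `‖w(t,·)‖_{L²} + ‖∂_x w(t,·)‖_{L²} + ‖∂_t w(t,·)‖_{L²}`, for functions `w` that are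
continuously differentiable. -/
def spaceTimeH1 (w : ℝ → ℝ → ℂ) (t : ℝ) : ENNReal :=
  eLpNorm (w t) 2 volume + eLpNorm (deriv (w t)) 2 volume
    + eLpNorm (fun x => deriv (fun τ => w τ x) t) 2 volume

end NLS

end

/-! In the profile variables s = t, y = x/t the equation becomes Ψ(V) = 0: an ordinary differential
equation in s, perturbed by s⁻²∂_y². The logarithmic phase of V₀ is the one for which i∂_sV₀ cancels
the cubic term, so Ψ(V₀) has order s⁻². The classes 𝒮_k are stable under all that is needed: gauge
invariance leaves a single factor e^{iφ} in f g h̄, ∂_s gains a power of s, and ∂_y costs only a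
logarithm.

On e^{iφ}s^{-k}Z the leading part of L₀ acts pointwise on (Z, Z̄) by a matrix of determinant k²,
invertible for k ≥ 1 wherever a vanishes or not; powers of ln s are removed by induction on the
power. Passing from L₀ to Ψ'(V) changes only terms two orders below the unknown, and each Newton
step (`Sym.exists_psi_succ`) gains one order.

For the exact solution write v = h + e^{it∂²}z with h an approximate solution. Conjugation by the
free group, an isometry of H³, removes the unbounded operator, and z solves an ordinary differential
equation in H³ with limit zero at infinity. Multiplication by h on H³ has norm O(t^{-1/2})
(`exists_norm_mulH_prof_le`), although ‖h‖ itself does not decay. Hence the right-hand side is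
Lipschitz with constant L/t, and `exists_terminal_solution` contracts in the norm sup t^m‖z(t)‖ once
m ≥ 2L + 1.

The constant L depends only on β, γ and the leading profile. So V_N is first improved to an order M
≥ max(N, 2L + 1), the equation is solved near the improved profile, and the two profiles differ by
an element of 𝒮_{N+1}, which contributes O(t^{-N}). Since H³ embeds in C², the solution is
classical. -/

noncomputable section

namespace NLS

/-! ### The symbol classes 𝒮_k and their algebra. -/

section

theorem exists_schwartz_mul {g : ℝ → ℂ} (hg : g.HasTemperateGrowth) (c : 𝓢(ℝ, ℂ)) :
    ∃ d : 𝓢(ℝ, ℂ), ∀ y, d y = g y * c y :=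
  ⟨SchwartzMap.smulLeftCLM ℂ g c, fun y => by
    simp [SchwartzMap.smulLeftCLM_apply_apply hg]⟩

theorem exists_schwartz_conj (c : 𝓢(ℝ, ℂ)) : ∃ d : 𝓢(ℝ, ℂ), ∀ y, d y = conj (c y) :=
  ⟨SchwartzMap.postcompCLM (𝕜 := ℝ) (Complex.conjCLE : ℂ →L[ℝ] ℂ) c, fun y => by simp⟩

theorem hasTemperateGrowth_coe (a : 𝓢(ℝ, ℝ)) :
    (fun y => (a y : ℂ)).HasTemperateGrowth :=
  Function.HasTemperateGrowth.comp Function.Complex.hasTemperateGrowth_ofReal a.hasTemperateGrowth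

theorem hasTemperateGrowth_deriv (a : 𝓢(ℝ, ℝ)) :
    (fun y => ((deriv a y : ℝ) : ℂ)).HasTemperateGrowth :=
  hasTemperateGrowth_coe (SchwartzMap.derivCLM ℝ ℝ a)

theorem exists_schwartz_coe (a : 𝓢(ℝ, ℝ)) : ∃ d : 𝓢(ℝ, ℂ), ∀ y, d y = (a y : ℂ) :=
  ⟨SchwartzMap.postcompCLM (𝕜 := ℝ) Complex.ofRealCLM a, fun y => by simp⟩

variable {β γ : ℝ} {a b : 𝓢(ℝ, ℝ)} {k l m : ℕ} {f g h W W' V R : ℝ → ℝ → ℂ}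

theorem conj_osc_mul_osc (s y : ℝ) : conj (osc β a b s y) * osc β a b s y = 1 := by
  rw [osc, ← Complex.exp_conj, ← Complex.exp_add]; simp

theorem norm_osc (s y : ℝ) : ‖osc β a b s y‖ = 1 := by
  rw [osc, mul_comm]; exact Complex.norm_exp_ofReal_mul_I _

variable (β a b) in
/-- The term `c(y) e^{iφ} (ln s)^j / s^k`. -/
def term (c : 𝓢(ℝ, ℂ)) (k j : ℕ) (s y : ℝ) : ℂ :=
  c y * (osc β a b s y * (Real.log s : ℂ) ^ j / (s : ℂ) ^ k)

variable (β a b) in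
/-- Inductive form of membership in `𝒮_k`. -/
inductive Sym (k : ℕ) : (ℝ → ℝ → ℂ) → Prop
  -- Both constructors constrain values for s > 0 only, so membership ignores s ≤ 0.
  | zero {W : ℝ → ℝ → ℂ} (hW : ∀ s, 0 < s → ∀ y, W s y = 0) : Sym k W
  | cons {W W' : ℝ → ℝ → ℂ} (hW : Sym k W) (c : 𝓢(ℝ, ℂ)) (k' j : ℕ) (hk : k ≤ k')
      (hW' : ∀ s, 0 < s → ∀ y, W' s y = W s y + term β a b c k' j s y) : Sym k W'

theorem Sym.congr (hW : Sym β a b k W) (h : ∀ s, 0 < s → ∀ y, W' s y = W s y) :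
    Sym β a b k W' := by
  cases hW with
  | zero h0 => exact .zero fun s hs y => by rw [h s hs, h0 s hs]
  | cons h0 c k' j hk h1 => exact .cons h0 c k' j hk fun s hs y => by rw [h s hs, h1 s hs]

theorem Sym.term (c : 𝓢(ℝ, ℂ)) {k' : ℕ} (j : ℕ) (hk : k ≤ k') :
    Sym β a b k (term β a b c k' j) :=
  .cons (.zero (W := fun _ _ => 0) fun _ _ _ => rfl) c k' j hk fun s _ y => by simp

theorem Sym.add (hf : Sym β a b k f) (hg : Sym β a b k g) :
    Sym β a b k (fun s y => f s y + g s y) := by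
  induction hg with
  | zero h0 => exact hf.congr fun s hs y => by rw [h0 s hs, add_zero]
  | cons _ c k' j hk h1 ih =>
    exact .cons ih c k' j hk fun s hs y => by rw [h1 s hs]; ring

theorem Sym.mono (hf : Sym β a b k f) (h : l ≤ k) : Sym β a b l f := by
  induction hf with
  | zero h0 => exact .zero h0
  | cons _ c k' j hk h1 ih => exact .cons ih c k' j (h.trans hk) h1

/-- An additive operation that maps terms to `𝒮_l` maps `𝒮_k` to `𝒮_l`. -/
theorem Sym.map (hf : Sym β a b k f) (A : ℝ → ℝ → ℂ → ℂ) (h0 : ∀ s y, A s y 0 = 0)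
    (hadd : ∀ s y z w, A s y (z + w) = A s y z + A s y w)
    (hA : ∀ (c : 𝓢(ℝ, ℂ)) (k' j : ℕ), k ≤ k' →
      Sym β a b l (fun s y => A s y (NLS.term β a b c k' j s y))) :
    Sym β a b l (fun s y => A s y (f s y)) := by
  induction hf with
  | zero hz => exact .zero fun s hs y => by rw [hz s hs, h0]
  | cons _ c k' j hk h1 ih =>
    exact (ih.add (hA c k' j hk)).congr fun s hs y => by rw [h1 s hs, hadd]

/-- Schwartz coefficients absorb any factor of temperate growth. This covers the powers of a and the
derivatives a', b' produced by the phase, and the powers of y produced by the chirp e^{ix²/4t}. -/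
theorem Sym.temperate_mul {g : ℝ → ℂ} (hg : g.HasTemperateGrowth) (hf : Sym β a b k f) :
    Sym β a b k (fun s y => g y * f s y) := by
  refine hf.map (fun _ y z => g y * z) (by simp) (by intros; ring) fun c k' j hk => ?_
  obtain ⟨d, hd⟩ := exists_schwartz_mul hg c
  exact (Sym.term d j hk).congr fun s _ y => by simp only [NLS.term, hd]; ring

theorem Sym.const_mul (z : ℂ) (hf : Sym β a b k f) : Sym β a b k (fun s y => z * f s y) :=
  hf.temperate_mul (.const z)

theorem Sym.neg (hf : Sym β a b k f) : Sym β a b k (fun s y => -f s y) :=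
  (hf.const_mul (-1)).congr fun s _ y => by ring

theorem Sym.sub (hf : Sym β a b k f) (hg : Sym β a b k g) :
    Sym β a b k (fun s y => f s y - g s y) :=
  (hf.add hg.neg).congr fun s _ y => by ring

theorem Sym.div_pow (n : ℕ) (hf : Sym β a b k f) :
    Sym β a b (k + n) (fun s y => f s y / (s : ℂ) ^ n) := by
  refine hf.map (fun s _ z => z / (s : ℂ) ^ n) (by simp) (by intros; ring) fun c k' j hk => ?_
  exact (Sym.term c j (Nat.add_le_add_right hk n)).congr fun s _ y => by
    simp only [NLS.term, pow_add]; ring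

theorem Sym.log_mul (hf : Sym β a b k f) :
    Sym β a b k (fun s y => (Real.log s : ℂ) * f s y) := by
  refine hf.map (fun s _ z => (Real.log s : ℂ) * z) (by simp) (by intros; ring)
    fun c k' j hk => ?_
  exact (Sym.term c (j + 1) hk).congr fun s _ y => by
    simp only [NLS.term, pow_add]; ring

/-- `f g \bar h`. -/
theorem Sym.mul_mul_conj (hf : Sym β a b k f) (hg : Sym β a b l g) (hh : Sym β a b m h) :
    Sym β a b (k + l + m) (fun s y => f s y * g s y * conj (h s y)) := by
  refine hf.map (fun s y z => z * g s y * conj (h s y)) (by simp) (by intros; ring)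
    fun c k' j hk => ?_
  refine hg.map (fun s y z => NLS.term β a b c k' j s y * z * conj (h s y)) (by simp)
    (by intros; ring) fun c₁ k₁ j₁ hk₁ => ?_
  refine hh.map (fun s y z => NLS.term β a b c k' j s y * NLS.term β a b c₁ k₁ j₁ s y * conj z)
    (by simp) (by intros; simp only [map_add]; ring) fun c₂ k₂ j₂ hk₂ => ?_
  obtain ⟨e, he⟩ := exists_schwartz_conj c₂
  obtain ⟨d₁, hd₁⟩ := exists_schwartz_mul c.hasTemperateGrowth c₁
  obtain ⟨d, hd⟩ := exists_schwartz_mul d₁.hasTemperateGrowth e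
  refine (Sym.term d (j + j₁ + j₂) (show k + l + m ≤ k' + k₁ + k₂ by omega)).congr
    fun s _ y => ?_
  simp only [NLS.term, hd, hd₁, he, map_mul, map_div₀, map_pow, Complex.conj_ofReal, pow_add]
  -- Gauge invariance: e^{iφ}e^{iφ}e^{-iφ} = e^{iφ}, so the triple product carries the same
  -- oscillation as each factor.
  have := conj_osc_mul_osc (β := β) (a := a) (b := b) s y
  linear_combination (c y * c₁ y * conj (c₂ y) * osc β a b s y * (Real.log s : ℂ) ^ j
    * (Real.log s : ℂ) ^ j₁ * (Real.log s : ℂ) ^ j₂ / ((s : ℂ) ^ k' * (s : ℂ) ^ k₁ * (s : ℂ) ^ k₂)) * this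

/-- Padding by zeros lets sums over different index rectangles be added over a common one, as is
needed to add a single term to the normal form in `InS`. -/
theorem sum_extend {M : Type*} [AddCommMonoid M] {S S' : Finset ℕ} (h : S ⊆ S') {R R' : Finset ℕ}
    (h' : R ⊆ R') (F : ℕ → ℕ → M) :
    ∑ p ∈ S', ∑ q ∈ R', (if p ∈ S ∧ q ∈ R then F p q else 0) = ∑ p ∈ S, ∑ q ∈ R, F p q := by
  rw [← Finset.sum_subset h]
  · refine Finset.sum_congr rfl fun p hp => ?_
    rw [← Finset.sum_subset h']
    · exact Finset.sum_congr rfl fun q hq => if_pos ⟨hp, hq⟩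
    · intro q _ hq; exact if_neg fun H => hq H.2
  · intro p _ hp
    exact Finset.sum_eq_zero fun q _ => if_neg fun H => hp H.1

theorem Sym.inS (hW : Sym β a b k W) : InS β a b k W := by
  induction hW with
  | zero h0 => exact ⟨0, 0, fun _ _ => 0, fun s hs y => by simp [h0 s hs]⟩
  | @cons W W' _ c k' j hk h1 ih =>
    obtain ⟨K, J, d, hd⟩ := ih
    have e1 : Finset.Icc k K ⊆ Finset.Icc k (max K k') :=
      Finset.Icc_subset_Icc le_rfl (le_max_left _ _)
    have e2 : Finset.range J ⊆ Finset.range (max J (j + 1)) :=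
      Finset.range_subset_range.2 (le_max_left _ _)
    have e3 : ({k'} : Finset ℕ) ⊆ Finset.Icc k (max K k') := by simp [hk]
    have e4 : ({j} : Finset ℕ) ⊆ Finset.range (max J (j + 1)) := by simp
    refine ⟨max K k', max J (j + 1), fun p q =>
      (if p ∈ Finset.Icc k K ∧ q ∈ Finset.range J then d p q else 0) +
        (if p ∈ ({k'} : Finset ℕ) ∧ q ∈ ({j} : Finset ℕ) then c else 0), fun s hs y => ?_⟩
    rw [h1 s hs, hd s hs, ← sum_extend e1 e2]
    have := sum_extend e3 e4 (fun p q => c y * (osc β a b s y * (Real.log s : ℂ) ^ q / (s : ℂ) ^ p))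
    simp only [Finset.sum_singleton] at this
    rw [NLS.term, ← this, ← Finset.sum_add_distrib]
    refine Finset.sum_congr rfl fun p _ => ?_
    rw [← Finset.sum_add_distrib]
    refine Finset.sum_congr rfl fun q _ => ?_
    simp only [add_apply, add_mul]
    congr 1 <;> split_ifs <;> simp

theorem Sym.finset_sum {ι : Type*} (S : Finset ι) {F : ι → ℝ → ℝ → ℂ}
    (hF : ∀ i ∈ S, Sym β a b k (F i)) : Sym β a b k (fun s y => ∑ i ∈ S, F i s y) := by
  classical
  induction S using Finset.induction_on with
  | empty => exact .zero fun _ _ _ => by simp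
  | insert i S hi ih =>
    refine ((hF i (by simp)).add (ih fun j hj => hF j (by simp [hj]))).congr fun s _ y => ?_
    rw [Finset.sum_insert hi]

theorem InS.sym (hW : InS β a b k W) : Sym β a b k W := by
  obtain ⟨K, J, c, hc⟩ := hW
  refine (Sym.finset_sum (F := fun p s y => ∑ q ∈ Finset.range J, NLS.term β a b (c p q) p q s y)
    (Finset.Icc k K) fun p hp => Sym.finset_sum _ fun q _ =>
      Sym.term _ _ (Finset.mem_Icc.1 hp).1).congr fun s hs y => hc s hs y

theorem inS_iff : InS β a b k W ↔ Sym β a b k W := ⟨InS.sym, Sym.inS⟩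

/-! ### Differentiation of symbols. -/

theorem hasDerivAt_osc_s {s : ℝ} (hs : 0 < s) (y : ℝ) :
    HasDerivAt (fun σ => osc β a b σ y)
      (osc β a b s y * (-Complex.I * β * (a y : ℂ) ^ 2 / s)) s := by
  have h1 : HasDerivAt (fun σ => phase β a b σ y) (-β * a y ^ 2 * s⁻¹) s :=
    ((Real.hasDerivAt_log hs.ne').const_mul _).add_const _
  refine ((h1.ofReal_comp.const_mul Complex.I).cexp).congr_deriv ?_
  rw [osc]; push_cast; ring

theorem hasDerivAt_osc_y (s y : ℝ) :
    HasDerivAt (fun η => osc β a b s η)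
      (osc β a b s y * (-2 * Complex.I * β * a y * deriv a y * Real.log s
        + Complex.I * deriv b y)) y := by
  have h1 : HasDerivAt (fun η => phase β a b s η)
      (-β * (2 * a y * deriv a y) * Real.log s + deriv b y) y := by
    refine ((((a.hasDerivAt y).pow 2).const_mul (-β)).mul_const (Real.log s)).add
      (b.hasDerivAt y) |>.congr_deriv ?_
    simp
  refine ((h1.ofReal_comp.const_mul Complex.I).cexp).congr_deriv ?_
  rw [osc]; push_cast; ring

theorem hasDerivAt_log_pow_div {s : ℝ} (hs : 0 < s) (j k : ℕ) :
    HasDerivAt (fun σ : ℝ => (Real.log σ : ℂ) ^ j / (σ : ℂ) ^ k)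
      (j * (Real.log s : ℂ) ^ (j - 1) / (s : ℂ) ^ (k + 1)
        - k * (Real.log s : ℂ) ^ j / (s : ℂ) ^ (k + 1)) s := by
  have hs' : (s : ℂ) ≠ 0 := by exact_mod_cast hs.ne'
  have h1 : HasDerivAt (fun σ : ℝ => (Real.log σ : ℂ)) ((s⁻¹ : ℝ) : ℂ) s :=
    (Real.hasDerivAt_log hs.ne').ofReal_comp
  have h2 : HasDerivAt (fun σ : ℝ => (σ : ℂ)) 1 s := (hasDerivAt_id s).ofReal_comp
  refine ((h1.pow j).div (h2.pow k) (pow_ne_zero _ hs')).congr_deriv ?_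
  rcases k with _ | k
  · simp [div_eq_mul_inv]
  · simp only [Nat.add_sub_cancel, Pi.pow_apply]; push_cast; field_simp; ring

theorem hasDerivAt_term_s (c : 𝓢(ℝ, ℂ)) (k j : ℕ) {s : ℝ} (hs : 0 < s) (y : ℝ) :
    HasDerivAt (fun σ => term β a b c k j σ y)
      (-Complex.I * β * (a y : ℂ) ^ 2 * (term β a b c k j s y / (s : ℂ) ^ 1)
        + (j * (term β a b c k (j - 1) s y / (s : ℂ) ^ 1)
          - k * (term β a b c k j s y / (s : ℂ) ^ 1))) s := by
  have hs' : (s : ℂ) ≠ 0 := by exact_mod_cast hs.ne'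
  have := ((hasDerivAt_osc_s (β := β) (a := a) (b := b) hs y).mul
    (hasDerivAt_log_pow_div hs j k)).const_mul (c y)
  simp only [term, mul_div_assoc]
  refine this.congr_deriv ?_
  field_simp
  ring

theorem hasDerivAt_term_y (c : 𝓢(ℝ, ℂ)) (k j : ℕ) (s y : ℝ) :
    HasDerivAt (fun η => term β a b c k j s η)
      (term β a b (SchwartzMap.derivCLM ℂ ℂ c) k j s y
        + ((-2 * Complex.I * β * a y * deriv a y) * (Real.log s * term β a b c k j s y)
        + (Complex.I * deriv b y) * term β a b c k j s y)) y := by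
  have := (c.hasDerivAt y).mul ((hasDerivAt_osc_y (β := β) (a := a) (b := b) s y).mul_const
    ((Real.log s : ℂ) ^ j / (s : ℂ) ^ k))
  simp only [term, mul_div_assoc]
  refine this.congr_deriv ?_
  rw [SchwartzMap.derivCLM_apply]
  ring

/-- The phase, the logarithms and the powers all depend on s with derivative O(1/s) relative to
themselves, whence the gain of one order. -/
theorem Sym.exists_hasDerivAt_s (hW : Sym β a b k W) : ∃ W', Sym β a b (k + 1) W' ∧
    ∀ s, 0 < s → ∀ y, HasDerivAt (fun σ => W σ y) (W' s y) s := by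
  induction hW with
  | @zero W h0 =>
    refine ⟨fun _ _ => 0, .zero fun _ _ _ => rfl, fun s hs y => ?_⟩
    refine (hasDerivAt_const s (0 : ℂ)).congr_of_eventuallyEq ?_
    filter_upwards [eventually_gt_nhds hs] with σ hσ using h0 σ hσ y
  | @cons W W' _ c k' j hk h1 ih =>
    obtain ⟨D, hD, hd⟩ := ih
    have t1 : Sym β a b k (NLS.term β a b c k' j) := .term c j hk
    have t2 : Sym β a b k (NLS.term β a b c k' (j - 1)) := .term c (j - 1) hk
    have ha := hasTemperateGrowth_coe a
    have hg : (fun y => -Complex.I * β * (a y : ℂ) ^ 2).HasTemperateGrowth := by fun_prop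
    refine ⟨_, hD.add (((t1.div_pow 1).temperate_mul hg).add
      (((t2.div_pow 1).const_mul j).sub ((t1.div_pow 1).const_mul k'))), fun s hs y => ?_⟩
    refine ((hd s hs y).add (hasDerivAt_term_s c k' j hs y)).congr_of_eventuallyEq ?_
    filter_upwards [eventually_gt_nhds hs] with σ hσ using h1 σ hσ y

/-- Differentiating the phase in y produces a factor ln s but no power of s. This is why 𝒮_k has to
contain logarithms. -/
theorem Sym.exists_hasDerivAt_y (hW : Sym β a b k W) : ∃ W', Sym β a b k W' ∧
    ∀ s, 0 < s → ∀ y, HasDerivAt (fun η => W s η) (W' s y) y := by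
  induction hW with
  | @zero W h0 =>
    refine ⟨fun _ _ => 0, .zero fun _ _ _ => rfl, fun s hs y => ?_⟩
    exact (hasDerivAt_const y (0 : ℂ)).congr_of_eventuallyEq (.of_forall fun η => h0 s hs η)
  | @cons W W' _ c k' j hk h1 ih =>
    obtain ⟨D, hD, hd⟩ := ih
    have t1 : Sym β a b k (NLS.term β a b c k' j) := .term c j hk
    have ha := hasTemperateGrowth_coe a
    have ha' := hasTemperateGrowth_deriv a
    have hb' := hasTemperateGrowth_deriv b
    have hg : (fun y => -2 * Complex.I * β * a y * deriv a y).HasTemperateGrowth := by fun_prop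
    have hg' : (fun y => Complex.I * deriv b y).HasTemperateGrowth := by fun_prop
    refine ⟨_, hD.add ((Sym.term (SchwartzMap.derivCLM ℂ ℂ c) j hk).add
      ((t1.log_mul.temperate_mul hg).add (t1.temperate_mul hg'))), fun s hs y => ?_⟩
    exact ((hd s hs y).add (hasDerivAt_term_y c k' j s y)).congr_of_eventuallyEq
      (.of_forall fun η => h1 s hs η)

theorem sym_V0 : Sym β a b 0 (V0 β a b) := by
  obtain ⟨d, hd⟩ := exists_schwartz_coe a
  exact (Sym.term d 0 le_rfl).congr fun s _ y => by simp [V0, NLS.term, hd]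

end

/-! ### The linearized operators and the approximate solutions. -/

section

variable {β γ : ℝ} {a b : 𝓢(ℝ, ℝ)} {k l m : ℕ} {f g h W W' V R : ℝ → ℝ → ℂ}

theorem ofReal_norm_sq (g : ℂ) : (‖g‖ : ℂ) ^ 2 = g * conj g := (Complex.mul_conj' g).symm

/-- Polynomial forms in g and ḡ, in which the factors group into products f g h̄ and
`Sym.mul_mul_conj` applies. -/
theorem G₁_eq (g : ℂ) : G₁ g = g * g * conj g := by
  rw [G₁, ofReal_norm_sq]; ring

theorem G₂_eq (g : ℂ) : G₂ g = g * g * conj g * g * conj g := by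
  rw [G₂, show (‖g‖ : ℂ) ^ 4 = ((‖g‖ : ℂ) ^ 2) ^ 2 by ring, ofReal_norm_sq]; ring

theorem dG₁_eq (g w : ℂ) : dG₁ g w = 2 * (g * w * conj g) + g * g * conj w := by
  rw [dG₁, ofReal_norm_sq]; ring

theorem dG₂_eq (g w : ℂ) :
    dG₂ g w = 3 * (g * w * conj g * g * conj g) + 2 * (g * g * conj w * g * conj g) := by
  rw [dG₂, show (‖g‖ : ℂ) ^ 4 = ((‖g‖ : ℂ) ^ 2) ^ 2 by ring, ofReal_norm_sq]; ring

theorem Sym.G₂ (hV : Sym β a b 0 V) : Sym β a b 0 (fun s y => G₂ (V s y)) :=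
  ((hV.mul_mul_conj hV hV).mul_mul_conj hV hV).congr fun _ _ _ => G₂_eq _

theorem Sym.dG₂ (hV : Sym β a b 0 V) (hW : Sym β a b k W) :
    Sym β a b k (fun s y => dG₂ (V s y) (W s y)) :=
  ((((hV.mul_mul_conj hW hV).mul_mul_conj hV hV).mono (by omega)).const_mul 3 |>.add
    ((((hV.mul_mul_conj hV hW).mul_mul_conj hV hV).mono (by omega)).const_mul 2)).congr
    fun _ _ _ => dG₂_eq _ _

theorem Sym.coe_div_mul (z : ℝ) (hf : Sym β a b k f) :
    Sym β a b (k + 1) (fun s y => ((z / s : ℝ) : ℂ) * f s y) :=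
  ((hf.div_pow 1).const_mul z).congr fun s _ y => by push_cast; ring

theorem Sym.coe_div_sq_mul (z : ℝ) (hf : Sym β a b k f) :
    Sym β a b (k + 2) (fun s y => ((z / s ^ 2 : ℝ) : ℂ) * f s y) :=
  ((hf.div_pow 2).const_mul z).congr fun s _ y => by push_cast; ring

theorem Sym.of_sub (hR : Sym β a b 1 (fun s y => V s y - V0 β a b s y)) : Sym β a b 0 V :=
  (sym_V0.add (hR.mono zero_le_one)).congr fun s _ y => by ring

theorem Sym.deriv_s (hW : Sym β a b k W) :
    Sym β a b (k + 1) (fun s y => deriv (fun σ => W σ y) s) := by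
  obtain ⟨D, hD, hd⟩ := hW.exists_hasDerivAt_s
  exact hD.congr fun s hs y => (hd s hs y).deriv

theorem Sym.deriv_y (hW : Sym β a b k W) :
    Sym β a b k (fun s y => deriv (fun η => W s η) y) := by
  obtain ⟨D, hD, hd⟩ := hW.exists_hasDerivAt_y
  exact hD.congr fun s hs y => (hd s hs y).deriv

theorem Sym.iteratedDeriv_two (hW : Sym β a b k W) :
    Sym β a b k (fun s y => iteratedDeriv 2 (fun η => W s η) y) :=
  hW.deriv_y.deriv_y.congr fun s _ y => by
    rw [iteratedDeriv_succ, iteratedDeriv_one]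

theorem Sym.differentiableAt_s (hW : Sym β a b k W) {s : ℝ} (hs : 0 < s) (y : ℝ) :
    DifferentiableAt ℝ (fun σ => W σ y) s := by
  obtain ⟨D, hD, hd⟩ := hW.exists_hasDerivAt_s
  exact (hd s hs y).differentiableAt

theorem Sym.differentiable_y (hW : Sym β a b k W) {s : ℝ} (hs : 0 < s) :
    Differentiable ℝ (W s) := by
  obtain ⟨D, hD, hd⟩ := hW.exists_hasDerivAt_y
  exact fun y => (hd s hs y).differentiableAt

theorem Sym.iteratedDeriv_two_add (hf : Sym β a b k f) (hg : Sym β a b l g) {s : ℝ} (hs : 0 < s)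
    (y : ℝ) : iteratedDeriv 2 (fun η => f s η + g s η) y
      = iteratedDeriv 2 (fun η => f s η) y + iteratedDeriv 2 (fun η => g s η) y := by
  simp only [iteratedDeriv_succ, iteratedDeriv_zero]
  rw [show deriv (fun η => f s η + g s η) = fun η => deriv (f s) η + deriv (g s) η from
    funext fun η => deriv_fun_add (hf.differentiable_y hs η) (hg.differentiable_y hs η)]
  exact deriv_fun_add (hf.deriv_y.differentiable_y hs y) (hg.deriv_y.differentiable_y hs y)

theorem L0_add (hf : Sym β a b k f) (hg : Sym β a b l g) {s : ℝ} (hs : 0 < s) (y : ℝ) :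
    L0 β γ a b (fun s y => f s y + g s y) s y = L0 β γ a b f s y + L0 β γ a b g s y := by
  simp only [L0, dL]
  rw [deriv_fun_add (hf.differentiableAt_s hs y) (hg.differentiableAt_s hs y)]
  simp only [dG₁, dG₂, map_add]
  ring

/-- Since |V₀|² = a² and V₀² = a²e^{2iφ}, the only oscillation left in the coefficients of L₀ is the
e^{2iφ} in front of the conjugate. -/
theorem L0_apply_of_hasDerivAt {z : ℂ} {s y : ℝ} (h : HasDerivAt (fun σ => f σ y) z s) :
    L0 β γ a b f s y = Complex.I * z
      - (β / s : ℝ) * (2 * (a y : ℂ) ^ 2 * f s y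
        + (a y : ℂ) ^ 2 * osc β a b s y ^ 2 * conj (f s y))
      - (γ / s ^ 2 : ℝ) * (3 * (a y : ℂ) ^ 4 * f s y
        + 2 * (a y : ℂ) ^ 4 * osc β a b s y ^ 2 * conj (f s y)) := by
  have h1 := conj_osc_mul_osc (β := β) (a := a) (b := b) s y
  rw [L0, dL, h.deriv, dG₁_eq, dG₂_eq, V0]
  simp only [map_mul, Complex.conj_ofReal]
  linear_combination (-((β / s : ℝ) : ℂ) * 2 * (a y : ℂ) ^ 2 * f s y
    - ((γ / s ^ 2 : ℝ) : ℂ) * (3 * (a y : ℂ) ^ 4 * f s y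
      * (1 + conj (osc β a b s y) * osc β a b s y)
      + 2 * (a y : ℂ) ^ 4 * osc β a b s y ^ 2 * conj (f s y))) * h1

/-- The explicit inversion of the leading part of `L₀`. -/
theorem L0_osc_mul (hk : 1 ≤ k) (j : ℕ) (Y Z : ℝ → ℂ)
    (hZ : ∀ y, Z y = (1 / (k : ℂ) ^ 2) *
        ((-(β : ℂ) * (a y : ℂ) ^ 2 + Complex.I * k) * Y y
          + (β : ℂ) * (a y : ℂ) ^ 2 * conj (Y y))) {s : ℝ} (hs : 0 < s) (y : ℝ) :
    L0 β γ a b (fun σ η => osc β a b σ η * (Real.log σ : ℂ) ^ j / (σ : ℂ) ^ k * Z η) s y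
      = osc β a b s y * (Real.log s : ℂ) ^ j / (s : ℂ) ^ (k + 1) * Y y
        + Complex.I * j * (osc β a b s y * (Real.log s : ℂ) ^ (j - 1) / (s : ℂ) ^ (k + 1)) * Z y
        + osc β a b s y * (Real.log s : ℂ) ^ j / (s : ℂ) ^ (k + 2) *
          (-3 * (γ : ℂ) * (a y : ℂ) ^ 4 * Z y - 2 * (γ : ℂ) * (a y : ℂ) ^ 4 * conj (Z y)) := by
  have hs' : (s : ℂ) ≠ 0 := by exact_mod_cast hs.ne'
  have hk' : (k : ℂ) ≠ 0 := by exact_mod_cast (by omega : k ≠ 0)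
  have hd := ((hasDerivAt_osc_s (β := β) (a := a) (b := b) hs y).mul
      (hasDerivAt_log_pow_div hs j k)).mul_const (Z y)
  have h1 := conj_osc_mul_osc (β := β) (a := a) (b := b) s y
  have e : osc β a b s y ^ 2 * conj (osc β a b s y * ((Real.log s : ℂ) ^ j / (s : ℂ) ^ k) * Z y)
      = osc β a b s y * (Real.log s : ℂ) ^ j / (s : ℂ) ^ k * conj (Z y) := by
    simp only [map_mul, map_div₀, map_pow, Complex.conj_ofReal]
    linear_combination (osc β a b s y * (Real.log s : ℂ) ^ j / (s : ℂ) ^ k * conj (Z y)) * h1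
  -- On the pair (Z, Z̄) the leading part has matrix rows (-βa² - ik, -βa²) and (-βa², -βa² + ik).
  -- Its determinant is k², and the formula for Z is the inverse.
  have hY : Y y = (-(β : ℂ) * (a y : ℂ) ^ 2 - Complex.I * k) * Z y
      - β * (a y : ℂ) ^ 2 * conj (Z y) := by
    rw [hZ y]
    simp only [map_mul, map_add, map_neg, map_div₀, map_pow, map_one, map_natCast,
      Complex.conj_ofReal, Complex.conj_I, Complex.conj_conj]
    field_simp
    linear_combination (k : ℂ) ^ 2 * Y y * Complex.I_sq
  simp only [mul_div_assoc] at hd ⊢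
  simp only [mul_div_assoc] at e
  rw [L0_apply_of_hasDerivAt (by simpa only [Pi.mul_apply] using hd)]
  simp only [mul_assoc] at e ⊢
  rw [e, hY]
  push_cast
  field_simp
  linear_combination (-osc β a b s y * (s : ℂ) ^ 4 * (s : ℂ) ^ (k * 2) * β * (a y : ℂ) ^ 2
    * (Real.log s : ℂ) ^ j * Z y) * Complex.I_sq

/-- Z depends on Y and k but not on j, and is Schwartz because the inverse matrix has coefficients
of temperate growth. -/
theorem exists_L0_term_leading (hk : 1 ≤ k) (Y : 𝓢(ℝ, ℂ)) : ∃ Z : 𝓢(ℝ, ℂ), ∀ j : ℕ,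
    ∃ ψ' : ℝ → ℝ → ℂ, Sym β a b (k + 2) ψ' ∧ ∀ s, 0 < s → ∀ y,
      L0 β γ a b (term β a b Z k j) s y = term β a b Y (k + 1) j s y
        + Complex.I * j * term β a b Z (k + 1) (j - 1) s y + ψ' s y := by
  obtain ⟨Yc, hYc⟩ := exists_schwartz_conj Y
  have ha := hasTemperateGrowth_coe a
  have g1 : (fun y => 1 / (k : ℂ) ^ 2 * (-(β : ℂ) * (a y : ℂ) ^ 2 + Complex.I * k)
    ).HasTemperateGrowth := by fun_prop
  have g2 : (fun y => 1 / (k : ℂ) ^ 2 * ((β : ℂ) * (a y : ℂ) ^ 2)).HasTemperateGrowth := by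
    fun_prop
  obtain ⟨Z₁, hZ₁⟩ := exists_schwartz_mul g1 Y
  obtain ⟨Z₂, hZ₂⟩ := exists_schwartz_mul g2 Yc
  obtain ⟨Zc, hZc⟩ := exists_schwartz_conj (Z₁ + Z₂)
  have g3 : (fun y => -3 * (γ : ℂ) * (a y : ℂ) ^ 4).HasTemperateGrowth := by fun_prop
  have g4 : (fun y => -2 * (γ : ℂ) * (a y : ℂ) ^ 4).HasTemperateGrowth := by fun_prop
  refine ⟨Z₁ + Z₂, fun j => ⟨_, ((Sym.term (Z₁ + Z₂) j le_rfl).temperate_mul g3).add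
    ((Sym.term Zc j le_rfl).temperate_mul g4), fun s hs y => ?_⟩⟩
  have := L0_osc_mul (β := β) (γ := γ) (a := a) (b := b) hk j Y (fun y => (Z₁ + Z₂) y)
    (fun y => by rw [add_apply, hZ₁, hZ₂, hYc]; ring) hs y
  rw [show term β a b (Z₁ + Z₂) k j = fun σ η =>
    osc β a b σ η * (Real.log σ : ℂ) ^ j / (σ : ℂ) ^ k * (Z₁ + Z₂) η from
    funext₂ fun _ _ => mul_comm _ _, this]
  simp only [term, hZc]
  ring

/-- Inverting the leading part on (ln s)^{j+1} leaves i(j+1)(ln s)^j Z at the same order in s. The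
induction hypothesis, applied to -i(j+1)Z, removes it, and the cascade ends at the power zero. -/
theorem exists_L0_term (hk : 1 ≤ k) (j : ℕ) : ∀ Y : 𝓢(ℝ, ℂ), ∃ f ψ' : ℝ → ℝ → ℂ,
    Sym β a b k f ∧ Sym β a b (k + 2) ψ' ∧ ∀ s, 0 < s → ∀ y,
      L0 β γ a b f s y = term β a b Y (k + 1) j s y + ψ' s y := by
  induction j with
  | zero =>
    intro Y
    obtain ⟨Z, hZ⟩ := exists_L0_term_leading (β := β) (γ := γ) (a := a) (b := b) hk Y
    obtain ⟨ψ', h1, h2⟩ := hZ 0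
    exact ⟨_, ψ', Sym.term Z 0 le_rfl, h1, fun s hs y => by rw [h2 s hs y]; simp⟩
  | succ j ih =>
    intro Y
    obtain ⟨Z, hZ⟩ := exists_L0_term_leading (β := β) (γ := γ) (a := a) (b := b) hk Y
    obtain ⟨ψ', h1, h2⟩ := hZ (j + 1)
    obtain ⟨f, ψ'', h3, h4, h5⟩ := ih ((-(Complex.I * (j + 1 : ℕ))) • Z)
    refine ⟨_, _, (Sym.term Z (j + 1) le_rfl).add h3, h1.add h4, fun s hs y => ?_⟩
    rw [L0_add (Sym.term Z (j + 1) le_rfl) h3 hs, h2 s hs, h5 s hs]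
    simp only [term, smul_apply, smul_eq_mul, Nat.add_sub_cancel]
    ring

/-- Solvability for `L₀` modulo two orders. -/
theorem Sym.exists_L0 (hk : 1 ≤ k) (hψ : Sym β a b (k + 1) W) : ∃ f ψ' : ℝ → ℝ → ℂ,
    Sym β a b k f ∧ Sym β a b (k + 2) ψ' ∧ ∀ s, 0 < s → ∀ y,
      L0 β γ a b f s y = W s y + ψ' s y := by
  induction hψ with
  | zero h0 =>
    refine ⟨fun _ _ => 0, fun _ _ => 0, .zero fun _ _ _ => rfl, .zero fun _ _ _ => rfl,
      fun s hs y => ?_⟩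
    rw [h0 s hs, L0_apply_of_hasDerivAt (f := fun _ _ => 0) (hasDerivAt_const s (0 : ℂ))]; simp
  | cons _ c k' j hk' h1 ih =>
    obtain ⟨f, ψ', h2, h3, h4⟩ := ih
    -- A source of order k' ≥ k + 1 is matched by a solution of order k' - 1 ≥ k; the bound k ≥ 1
    -- keeps the determinant (k' - 1)² nonzero.
    obtain ⟨n, rfl⟩ : ∃ n, k' = n + 1 := ⟨k' - 1, by omega⟩
    obtain ⟨f', ψ'', h5, h6, h7⟩ := exists_L0_term (β := β) (γ := γ) (a := a) (b := b)
      (show 1 ≤ n by omega) j c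
    refine ⟨_, _, h2.add (h5.mono (by omega)), h3.add (h6.mono (by omega)), fun s hs y => ?_⟩
    rw [L0_add h2 h5 hs, h4 s hs, h7 s hs, h1 s hs]
    ring

/-- In the cubic part one factor V - V₀ of order 1 splits off, which together with β/s gains two
orders. The quintic parts carry s⁻² already, so no cancellation between them is needed. -/
theorem Sym.dL_sub_L0 (hR : Sym β a b 1 (fun s y => V s y - V0 β a b s y)) (hf : Sym β a b k f) :
    Sym β a b (k + 2) (fun s y => dL β γ V f s y - L0 β γ a b f s y) := by
  have hV := hR.of_sub
  have h0 : Sym β a b 0 (V0 β a b) := sym_V0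
  have h1 := ((((hR.mul_mul_conj hf hV).add ((h0.mul_mul_conj hf hR).mono (by omega))).const_mul 2).add
    ((((hR.mul_mul_conj hV hf)).mono (by omega)).add ((h0.mul_mul_conj hR hf).mono (by omega))))
  refine ((((h1.coe_div_mul β).mono (show k + 2 ≤ _ by omega)).neg.sub
    ((hV.dG₂ hf).coe_div_sq_mul γ)).add ((h0.dG₂ hf).coe_div_sq_mul γ)).congr fun s _ y => ?_
  simp only [L0, dL, dG₁_eq, map_sub]
  ring

/-- Solvability for `Ψ'(V)` modulo two orders. -/
theorem Sym.exists_dPsi (hR : Sym β a b 1 (fun s y => V s y - V0 β a b s y)) (hk : 1 ≤ k)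
    (hψ : Sym β a b (k + 1) W) : ∃ f ψ' : ℝ → ℝ → ℂ,
    Sym β a b k f ∧ Sym β a b (k + 2) ψ' ∧ ∀ s, 0 < s → ∀ y,
      dPsi β γ V f s y = W s y + ψ' s y := by
  obtain ⟨f, ψ', h1, h2, h3⟩ := hψ.exists_L0 (γ := γ) hk
  refine ⟨f, _, h1, (h2.add (hR.dL_sub_L0 (γ := γ) h1)).add
    (h1.iteratedDeriv_two.coe_div_sq_mul 1), fun s hs y => ?_⟩
  rw [dPsi]
  linear_combination h3 s hs y

/-- The phase was chosen for this: i∂_se^{iφ} = (βa²/s)e^{iφ} cancels the cubic term exactly, and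
all that remains carries s⁻². -/
theorem Sym.psi_V0 : Sym β a b 2 (Psi β γ (V0 β a b)) := by
  have h0 : Sym β a b 0 (V0 β a b) := sym_V0
  refine ((h0.iteratedDeriv_two.coe_div_sq_mul 1).sub (h0.G₂.coe_div_sq_mul γ)).congr
    fun s hs y => ?_
  have h1 := conj_osc_mul_osc (β := β) (a := a) (b := b) s y
  have hd := (hasDerivAt_osc_s (β := β) (a := a) (b := b) hs y).const_mul (a y : ℂ)
  rw [Psi, show (fun σ => V0 β a b σ y) = fun σ => (a y : ℂ) * osc β a b σ y from rfl, hd.deriv,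
    G₁_eq]
  simp only [V0, map_mul, Complex.conj_ofReal]
  push_cast
  linear_combination (-(a y : ℂ) ^ 3 * osc β a b s y * β / s) * Complex.I_sq
    - (β / s * (a y : ℂ) ^ 3 * osc β a b s y) * h1

/-- One step of the construction of approximate solutions. -/
theorem Sym.exists_psi_succ {n : ℕ} (hR : Sym β a b 1 (fun s y => V s y - V0 β a b s y))
    (hV' : Sym β a b (n + 2) (Psi β γ V)) : ∃ V' : ℝ → ℝ → ℂ,
    Sym β a b 1 (fun s y => V' s y - V0 β a b s y) ∧
    Sym β a b (n + 1) (fun s y => V' s y - V s y) ∧ Sym β a b (n + 3) (Psi β γ V') := by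
  -- Newton step: f solves Ψ'(V)f = -Ψ(V) up to an error ψ' of order n + 3.
  obtain ⟨f, ψ', h1, h2, h3⟩ := hR.exists_dPsi (γ := γ) (show 1 ≤ n + 1 by omega) hV'.neg
  have hV := hR.of_sub
  have hV'' : Sym β a b 0 (fun s y => V s y + f s y) := hV.add (h1.mono (by omega))
  refine ⟨fun s y => V s y + f s y, (hR.add (h1.mono (by omega))).congr fun s _ y => ?_,
    h1.congr fun s _ y => ?_, ?_⟩
  · ring
  · ring
  -- The part of G₁(V + f) beyond first order in f: it has order at least 2(n + 1) ≥ n + 2, and the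
  -- factor β/s raises this to n + 3.
  have hq := ((((hV.mul_mul_conj h1 h1).mono (show n + 2 ≤ _ by omega)).const_mul 2).add
    ((h1.mul_mul_conj h1 hV).mono (show n + 2 ≤ _ by omega))).add
    ((h1.mul_mul_conj h1 h1).mono (show n + 2 ≤ _ by omega))
  -- The factor s⁻² makes a first-order difference enough for the quintic term; it is telescoped
  -- over the five factors.
  have hG : Sym β a b (n + 1) (fun s y => NLS.G₂ (V s y + f s y) - NLS.G₂ (V s y)) := by
    have e1 := (h1.mul_mul_conj hV'' hV'').mul_mul_conj hV'' hV''
    have e2 := (hV.mul_mul_conj h1 hV'').mul_mul_conj hV'' hV''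
    have e3 := (hV.mul_mul_conj hV h1).mul_mul_conj hV'' hV''
    have e4 := (hV.mul_mul_conj hV hV).mul_mul_conj h1 hV''
    have e5 := (hV.mul_mul_conj hV hV).mul_mul_conj hV h1
    refine (((((e1.mono (show n + 1 ≤ _ by omega)).add (e2.mono (show n + 1 ≤ _ by omega))).add
      (e3.mono (show n + 1 ≤ _ by omega))).add (e4.mono (show n + 1 ≤ _ by omega))).add
      (e5.mono (show n + 1 ≤ _ by omega))).congr fun s _ y => ?_
    rw [G₂_eq, G₂_eq]
    simp only [map_add]
    ring
  refine ((((h2.sub (hq.coe_div_mul β)).sub (hG.coe_div_sq_mul γ))).add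
    ((hV.dG₂ h1).coe_div_sq_mul γ)).congr fun s hs y => ?_
  have h4 := h3 s hs y
  simp only [dPsi, dL, Psi] at h4 ⊢
  rw [hV.iteratedDeriv_two_add h1 hs,
    deriv_fun_add (hV.differentiableAt_s hs y) (h1.differentiableAt_s hs y)]
  rw [dG₁_eq] at h4
  simp only [G₁_eq, map_add] at h4 ⊢
  linear_combination h4

theorem exists_approx (β γ : ℝ) (a b : 𝓢(ℝ, ℝ)) :
    ∃ V : ℕ → ℝ → ℝ → ℂ, V 0 = V0 β a b ∧ ∀ n : ℕ,
      Sym β a b 1 (fun s y => V n s y - V0 β a b s y) ∧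
      Sym β a b (n + 1) (fun s y => V (n + 1) s y - V n s y) ∧
      Sym β a b (n + 2) (Psi β γ (V n)) := by
  -- The hypotheses sit inside the existential, so that `choose` returns a next profile for every V
  -- and plain recursion applies.
  have step : ∀ n : ℕ, ∀ V : ℝ → ℝ → ℂ, ∃ V' : ℝ → ℝ → ℂ,
      Sym β a b 1 (fun s y => V s y - V0 β a b s y) ∧ Sym β a b (n + 2) (Psi β γ V) →
      Sym β a b 1 (fun s y => V' s y - V0 β a b s y) ∧
      Sym β a b (n + 1) (fun s y => V' s y - V s y) ∧ Sym β a b (n + 3) (Psi β γ V') := by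
    intro n V
    by_cases h : Sym β a b 1 (fun s y => V s y - V0 β a b s y) ∧ Sym β a b (n + 2) (Psi β γ V)
    · obtain ⟨V', h'⟩ := h.1.exists_psi_succ h.2
      exact ⟨V', fun _ => h'⟩
    · exact ⟨V, fun h' => absurd h' h⟩
  choose F hF using step
  let V : ℕ → ℝ → ℝ → ℂ := fun n => Nat.rec (V0 β a b) F n
  have hV : ∀ n, Sym β a b 1 (fun s y => V n s y - V0 β a b s y) ∧
      Sym β a b (n + 2) (Psi β γ (V n)) := by
    intro n
    induction n with
    | zero => exact ⟨.zero fun _ _ _ => sub_self _, Sym.psi_V0⟩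
    | succ n ih => exact ⟨(hF n (V n) ih).1, (hF n (V n) ih).2.2⟩
  exact ⟨V, rfl, fun n => ⟨(hV n).1, (hF n (V n) (hV n)).2.1, (hV n).2⟩⟩

/-- Approximate solutions can be improved to any order. -/
theorem Sym.exists_psi_of_le {N M : ℕ} (hNM : N ≤ M)
    (hR : Sym β a b 1 (fun s y => V s y - V0 β a b s y))
    (hV' : Sym β a b (N + 2) (Psi β γ V)) : ∃ V' : ℝ → ℝ → ℂ,
    Sym β a b 1 (fun s y => V' s y - V0 β a b s y) ∧
    Sym β a b (N + 1) (fun s y => V' s y - V s y) ∧ Sym β a b (M + 2) (Psi β γ V') := by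
  induction M, hNM using Nat.le_induction with
  | base => exact ⟨V, hR, .zero fun _ _ _ => sub_self _, hV'⟩
  | succ M hM ih =>
    obtain ⟨V₁, h1, h2, h3⟩ := ih
    obtain ⟨V₂, h4, h5, h6⟩ := h1.exists_psi_succ h3
    exact ⟨V₂, h4, ((h5.mono (by omega)).add h2).congr fun s _ y => by ring, h6⟩

end

/-! ### A terminal value problem at infinity. -/

section

open BoundedContinuousFunction in
/-- A terminal value problem at infinity: if `f` is Lipschitz with constant `K / t` in the ball of
radius `t ^ (-m)` and `f t 0 = O(t ^ (-m - 1))`, then `z' = f t z` has a solution that is bounded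
by `t ^ (-m)`. -/
theorem exists_terminal_solution {X : Type*} [NormedAddCommGroup X] [NormedSpace ℝ X]
    [CompleteSpace X] {f : ℝ → X → X} {T m K : ℝ} (hT : 0 < T) (hK0 : 0 ≤ K) (hK : 2 * K + 1 ≤ m)
    (hf : ContinuousOn (Function.uncurry f) (Ici T ×ˢ univ))
    (hL : ∀ t, T ≤ t → ∀ z z' : X, ‖z‖ ≤ t ^ (-m) → ‖z'‖ ≤ t ^ (-m) →
      ‖f t z - f t z'‖ ≤ K / t * ‖z - z'‖)
    (h0 : ∀ t, T ≤ t → ‖f t 0‖ ≤ 1 / 2 * t ^ (-m - 1)) :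
    ∃ z : ℝ → X, ∀ t, T < t → HasDerivAt z (f t (z t)) t ∧ ‖z t‖ ≤ t ^ (-m) := by
  have hm : 0 < m := by linarith
  -- Time is frozen below T, so that all curves are continuous on the whole line.
  let S : ℝ → ℝ := fun t => max t T
  have hS : Continuous S := continuous_id.max continuous_const
  have hST : ∀ t, T ≤ S t := fun t => le_max_right _ _
  have hS0 : ∀ t, 0 < S t := fun t => hT.trans_le (hST t)
  have hSr : ∀ r : ℝ, Continuous fun t => S t ^ r := fun r =>
    hS.rpow_const fun t => Or.inl (hS0 t).ne'
  -- The unknown is ω = t^m z, taken in the unit ball of bounded continuous functions; this encodes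
  -- the bound ‖z‖ ≤ t^{-m}.
  let B := Metric.closedBall (0 : ℝ →ᵇ X) 1
  have hB : ∀ (ω : B) t, ‖(ω : ℝ →ᵇ X) t‖ ≤ 1 := fun ω t =>
    ((ω : ℝ →ᵇ X).norm_coe_le_norm t).trans (mem_closedBall_zero_iff.1 ω.2)
  let H : B → ℝ → X := fun ω τ => f (S τ) (S τ ^ (-m) • (ω : ℝ →ᵇ X) τ)
  have hHc : ∀ ω, Continuous (H ω) := fun ω =>
    hf.comp_continuous (hS.prodMk ((hSr (-m)).smul (ω : ℝ →ᵇ X).continuous))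
      fun t => ⟨hST t, mem_univ _⟩
  have hz : ∀ (ω : B) τ, ‖S τ ^ (-m) • (ω : ℝ →ᵇ X) τ‖ ≤ S τ ^ (-m) := fun ω τ => by
    rw [norm_smul, Real.norm_of_nonneg (Real.rpow_nonneg (hS0 τ).le _)]
    exact mul_le_of_le_one_right (Real.rpow_nonneg (hS0 τ).le _) (hB ω τ)
  have hpow : ∀ τ, S τ ^ (-m) / S τ = S τ ^ (-m - 1) := fun τ =>
    (Real.rpow_sub_one (hS0 τ).ne' _).symm
  have hHd : ∀ ω ω' τ, ‖H ω τ - H ω' τ‖ ≤ K * dist ω ω' * S τ ^ (-m - 1) := fun ω ω' τ => by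
    refine (hL _ (hST τ) _ _ (hz ω τ) (hz ω' τ)).trans ?_
    rw [← smul_sub, norm_smul, Real.norm_of_nonneg (Real.rpow_nonneg (hS0 τ).le _), ← hpow]
    have : ‖(ω : ℝ →ᵇ X) τ - (ω' : ℝ →ᵇ X) τ‖ ≤ dist ω ω' := by
      rw [← dist_eq_norm]; exact dist_coe_le_dist τ
    calc _ = K * ‖(ω : ℝ →ᵇ X) τ - (ω' : ℝ →ᵇ X) τ‖ * (S τ ^ (-m) / S τ) := by ring
      _ ≤ _ := by
        have := Real.rpow_nonneg (hS0 τ).le (-m)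
        have := hS0 τ
        gcongr
  have hHb : ∀ ω τ, ‖H ω τ‖ ≤ (K + 1 / 2) * S τ ^ (-m - 1) := fun ω τ => by
    have h1 := hL _ (hST τ) _ 0 (hz ω τ) (by simpa using Real.rpow_nonneg (hS0 τ).le _)
    rw [sub_zero] at h1
    calc ‖H ω τ‖ ≤ ‖H ω τ - f (S τ) 0‖ + ‖f (S τ) 0‖ := by
          simpa using norm_add_le (H ω τ - f (S τ) 0) (f (S τ) 0)
      _ ≤ K / S τ * S τ ^ (-m) + 1 / 2 * S τ ^ (-m - 1) := by
          refine add_le_add (h1.trans ?_) (h0 _ (hST τ))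
          have := hS0 τ
          gcongr
          exact hz ω τ
      _ = _ := by rw [← hpow]; ring
  have hint : ∀ t, T ≤ t → IntegrableOn (fun τ => S τ ^ (-m - 1)) (Ioi t) := fun t ht =>
    (integrableOn_Ioi_rpow_of_lt (by linarith : -m - 1 < -1) (hT.trans_le ht)).congr_fun
      (fun τ hτ => by simp only [S]; rw [max_eq_left (ht.trans (le_of_lt hτ))]) measurableSet_Ioi
  have hval : ∀ t, T ≤ t → ∫ τ in Ioi t, S τ ^ (-m - 1) = t ^ (-m) / m := fun t ht => by
    rw [setIntegral_congr_fun measurableSet_Ioi (g := fun τ : ℝ => τ ^ (-m - 1))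
      (fun τ hτ => by simp only [S]; rw [max_eq_left (ht.trans (le_of_lt hτ))]),
      integral_Ioi_rpow_of_lt (by linarith) (hT.trans_le ht)]
    rw [sub_add_cancel, neg_div_neg_eq]
  have hHi : ∀ ω t, T ≤ t → IntegrableOn (H ω) (Ioi t) := fun ω t ht =>
    ((hint t ht).const_mul (K + 1 / 2)).mono' (hHc ω).aestronglyMeasurable
      (.of_forall fun τ => hHb ω τ)
  have hIeq : ∀ ω t, T ≤ t → ∫ τ in Ioi t, H ω τ
      = (∫ τ in Ioi T, H ω τ) - ∫ τ in T..t, H ω τ := fun ω t ht => by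
    rw [eq_sub_iff_add_eq', intervalIntegral.integral_interval_add_Ioi (hHi ω T le_rfl)
      (hHi ω t ht)]
  -- Integrating τ^{-m-1} over (t, ∞) gives t^{-m}/m. As 2K + 1 ≤ m, one has (K + 1/2)/m ≤ 1 here,
  -- which gives a self-map, and K/m ≤ 1/2 in the next estimate, which gives the contraction.
  have hIb : ∀ ω t, T ≤ t → ‖∫ τ in Ioi t, H ω τ‖ ≤ t ^ (-m) := fun ω t ht => by
    refine (norm_integral_le_of_norm_le ((hint t ht).const_mul (K + 1 / 2))
      (.of_forall fun τ => hHb ω τ)).trans ?_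
    rw [integral_const_mul, hval t ht, mul_div_left_comm]
    refine mul_le_of_le_one_right (Real.rpow_nonneg (hT.trans_le ht).le _) ?_
    rw [div_le_one hm]; linarith
  have hId : ∀ ω ω' t, T ≤ t → ‖(∫ τ in Ioi t, H ω τ) - ∫ τ in Ioi t, H ω' τ‖
      ≤ 1 / 2 * dist ω ω' * t ^ (-m) := fun ω ω' t ht => by
    rw [← integral_sub (hHi ω t ht) (hHi ω' t ht)]
    refine (norm_integral_le_of_norm_le ((hint t ht).const_mul (K * dist ω ω'))
      (.of_forall fun τ => hHd ω ω' τ)).trans ?_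
    rw [integral_const_mul, hval t ht]
    have h1 := Real.rpow_nonneg (hT.trans_le ht).le (-m)
    have h2 : K / m ≤ 1 / 2 := by rw [div_le_iff₀ hm]; linarith
    calc _ = K / m * dist ω ω' * t ^ (-m) := by ring
      _ ≤ _ := by gcongr
  let F : B → ℝ → X := fun ω t => -(S t ^ m • ∫ τ in Ioi (S t), H ω τ)
  have hFc : ∀ ω, Continuous (F ω) := fun ω => by
    refine ((hSr m).smul ?_).neg
    -- The tail integral is a constant minus a primitive, hence continuous in t.
    simp_rw [fun t => hIeq ω (S t) (hST t)]
    exact continuous_const.sub ((intervalIntegral.continuous_primitive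
      (fun a b => (hHc ω).intervalIntegrable a b) T).comp hS)
  have hcancel : ∀ t, S t ^ m * S t ^ (-m) = 1 := fun t => by
    rw [← Real.rpow_add (hS0 t)]; simp
  have hFb : ∀ ω t, ‖F ω t‖ ≤ 1 := fun ω t => by
    rw [norm_neg, norm_smul, Real.norm_of_nonneg (Real.rpow_nonneg (hS0 t).le _), ← hcancel t]
    exact mul_le_mul_of_nonneg_left (hIb ω _ (hST t)) (Real.rpow_nonneg (hS0 t).le _)
  let Φ : B → B := fun ω => ⟨.ofNormedAddCommGroup (F ω) (hFc ω) 1 (hFb ω), by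
    simp only [B, Metric.mem_closedBall, dist_zero_right]
    exact norm_ofNormedAddCommGroup_le _ zero_le_one _⟩
  have hΦ : ContractingWith (1 / 2) Φ := by
    refine ⟨by norm_num, LipschitzWith.of_dist_le_mul fun ω ω' => ?_⟩
    rw [Subtype.dist_eq, dist_le (by positivity)]
    intro t
    change dist (F ω t) (F ω' t) ≤ _
    rw [dist_neg_neg, dist_eq_norm, ← smul_sub, norm_smul,
      Real.norm_of_nonneg (Real.rpow_nonneg (hS0 t).le _)]
    calc _ ≤ S t ^ m * (1 / 2 * dist ω ω' * S t ^ (-m)) :=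
          mul_le_mul_of_nonneg_left (hId ω ω' _ (hST t)) (Real.rpow_nonneg (hS0 t).le _)
      _ = 1 / 2 * dist ω ω' * (S t ^ m * S t ^ (-m)) := by ring
      _ = _ := by rw [hcancel]; simp
  have : Nonempty B := ⟨⟨0, by simp [B]⟩⟩
  have : CompleteSpace B := Metric.isClosed_closedBall.completeSpace_coe
  let ω := ContractingWith.fixedPoint Φ hΦ
  have hω : Φ ω = ω := hΦ.fixedPoint_isFixedPt
  have hω' : ∀ t, (ω : ℝ →ᵇ X) t = F ω t := fun t => by
    conv_lhs => rw [← hω]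
    rfl
  have hzt : ∀ t, S t ^ (-m) • (ω : ℝ →ᵇ X) t = -∫ τ in Ioi (S t), H ω τ := fun t => by
    rw [hω', smul_neg, smul_smul, mul_comm, hcancel, one_smul]
  refine ⟨fun t => -∫ τ in Ioi (S t), H ω τ, fun t ht => ⟨?_, ?_⟩⟩
  · have hSt : S t = t := max_eq_left ht.le
    -- By the fixed-point identity, the argument of f inside the integrand at time t is the solution
    -- itself.
    have e : f t (-∫ τ in Ioi (S t), H ω τ) = H ω t := by
      simp only [H]; rw [hzt, hSt]
    rw [e]
    have h1 : HasDerivAt (fun t => ∫ τ in T..t, H ω τ) (H ω t) t :=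
      intervalIntegral.integral_hasDerivAt_right ((hHc ω).intervalIntegrable _ _)
        ((hHc ω).stronglyMeasurableAtFilter _ _) (hHc ω).continuousAt
    have h2 := ((h1.const_sub (∫ τ in Ioi T, H ω τ))).neg
    rw [neg_neg] at h2
    refine h2.congr_of_eventuallyEq ?_
    filter_upwards [eventually_gt_nhds ht] with τ hτ
    simp only [Pi.neg_apply]
    rw [← hIeq ω τ hτ.le, show S τ = τ from max_eq_left hτ.le]
  · have hSt : S t = t := max_eq_left ht.le
    simp only [norm_neg, hSt]
    exact hIb ω t ht.le

end

section

/-! ### Schwartz functions: `L²` norms of derivatives -/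

/-- The derivative on Schwartz functions. -/
abbrev dS : 𝓢(ℝ, ℂ) →L[ℂ] 𝓢(ℝ, ℂ) := SchwartzMap.derivCLM ℂ ℂ

/-- The `L²` norm of a Schwartz function. -/
def n2 (f : 𝓢(ℝ, ℂ)) : ℝ := ‖f.toLp 2 (volume : Measure ℝ)‖

theorem n2_nonneg (f : 𝓢(ℝ, ℂ)) : 0 ≤ n2 f := norm_nonneg _

theorem n2_add_le (f g : 𝓢(ℝ, ℂ)) : n2 (f + g) ≤ n2 f + n2 g := by
  have h := (SchwartzMap.toLpCLM ℂ ℂ 2 (volume : Measure ℝ)).map_add f g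
  have h' := norm_add_le (SchwartzMap.toLpCLM ℂ ℂ 2 (volume : Measure ℝ) f)
    (SchwartzMap.toLpCLM ℂ ℂ 2 (volume : Measure ℝ) g)
  rw [← h] at h'
  exact h'

theorem n2_le_mul {f g : 𝓢(ℝ, ℂ)} {R : ℝ} (h : ∀ x, ‖f x‖ ≤ R * ‖g x‖) : n2 f ≤ R * n2 g := by
  refine Lp.norm_le_mul_norm_of_ae_le_mul ?_
  filter_upwards [f.coeFn_toLp 2 (volume : Measure ℝ), g.coeFn_toLp 2 (volume : Measure ℝ)]
    with x hf hg
  rw [hf, hg]; exact h x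

theorem n2_congr {f g : 𝓢(ℝ, ℂ)} (h : ∀ x, ‖f x‖ = ‖g x‖) : n2 f = n2 g :=
  le_antisymm (by simpa using n2_le_mul (R := 1) fun x => by simp [h])
    (by simpa using n2_le_mul (R := 1) fun x => by simp [h])

theorem eLpNorm_eq_n2 (f : 𝓢(ℝ, ℂ)) : eLpNorm f 2 volume = ENNReal.ofReal (n2 f) := by
  rw [n2, SchwartzMap.norm_toLp, ENNReal.ofReal_toReal (f.memLp 2 volume).eLpNorm_ne_top]

theorem n2_sq (f : 𝓢(ℝ, ℂ)) : n2 f ^ 2 = ∫ x, ‖f x‖ ^ 2 := by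
  rw [n2, SchwartzMap.norm_toLp' (by simp) (by simp)]
  rw [← Real.rpow_natCast, ← Real.rpow_mul (by positivity)]
  simp

theorem integrable_norm_sq (f : 𝓢(ℝ, ℂ)) : Integrable (fun x => ‖f x‖ ^ 2) :=
  (f.memLp 2).integrable_norm_pow (by simp)

/-- The one-dimensional Sobolev inequality. -/
theorem norm_sq_le_n2 (f : 𝓢(ℝ, ℂ)) (x : ℝ) : ‖f x‖ ^ 2 ≤ n2 f ^ 2 + n2 (dS f) ^ 2 := by
  have hd : ∀ y, HasDerivAt (fun y => ‖f y‖ ^ 2) (2 * inner ℝ (f y) (dS f y)) y := fun y => by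
    simpa using (f.hasDerivAt y).norm_sq
  have hb : ∀ y, ‖2 * inner ℝ (f y) (dS f y)‖ ≤ ‖f y‖ ^ 2 + ‖dS f y‖ ^ 2 := fun y => by
    rw [norm_mul, Real.norm_two]
    have := norm_inner_le_norm (𝕜 := ℝ) (f y) (dS f y)
    nlinarith [sq_nonneg (‖f y‖ - ‖dS f y‖)]
  have hi : Integrable (fun y => ‖f y‖ ^ 2 + ‖dS f y‖ ^ 2) :=
    (integrable_norm_sq f).add (integrable_norm_sq (dS f))
  have hc : Continuous fun y => 2 * inner ℝ (f y) (dS f y) := by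
    have h1 := f.continuous
    have h2 := (dS f).continuous
    fun_prop
  have hi' : Integrable (fun y => 2 * inner ℝ (f y) (dS f y)) :=
    hi.mono' hc.aestronglyMeasurable (.of_forall hb)
  have ht : Filter.Tendsto (fun y => ‖f y‖ ^ 2) Filter.atBot (nhds 0) := by
    have := ((f.tendsto_cocompact).mono_left _root_.atBot_le_cocompact).norm.pow 2
    simpa using this
  -- |f(x)|² is the integral of 2 Re(f̄ f') over (-∞, x], and the integrand is at most |f|² + |f'|².
  have h1 := integral_Iic_of_hasDerivAt_of_tendsto' (a := x) (fun y _ => hd y) hi'.integrableOn ht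
  rw [sub_zero] at h1
  rw [← h1, n2_sq, n2_sq, ← integral_add (integrable_norm_sq f) (integrable_norm_sq (dS f))]
  calc _ ≤ ∫ y in Iic x, (‖f y‖ ^ 2 + ‖dS f y‖ ^ 2) :=
        setIntegral_mono hi'.integrableOn hi.integrableOn fun y => (le_abs_self _).trans (hb y)
    _ ≤ _ := setIntegral_le_integral hi (.of_forall fun y => by positivity)

/-! ### The Sobolev space `H³` as a closure of Schwartz functions -/

/-- The first four derivatives, as elements of `L²`. -/
def jet : 𝓢(ℝ, ℂ) →ₗ[ℂ] (Fin 4 → Lp ℂ 2 (volume : Measure ℝ)) :=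
  LinearMap.pi fun j => (SchwartzMap.toLpCLM ℂ ℂ 2 (volume : Measure ℝ) ∘L dS ^ (j : ℕ)).toLinearMap

/-- The Sobolev space `H³(ℝ)`. -/
def H3 : Type := (LinearMap.range jet).topologicalClosure

instance : NormedAddCommGroup H3 :=
  inferInstanceAs (NormedAddCommGroup (LinearMap.range jet).topologicalClosure)

instance : NormedSpace ℂ H3 :=
  inferInstanceAs (NormedSpace ℂ (LinearMap.range jet).topologicalClosure)

instance : CompleteSpace H3 :=
  (Submodule.isClosed_topologicalClosure _).completeSpace_coe

/-- The inclusion of the Schwartz space into `H³`. -/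
def toH3 : 𝓢(ℝ, ℂ) →ₗ[ℂ] H3 :=
  jet.codRestrict (LinearMap.range jet).topologicalClosure fun f => Submodule.le_topologicalClosure _ (LinearMap.mem_range_self _ f)

theorem denseRange_toH3 : DenseRange toH3 := by
  have h : DenseRange (jet.codRestrict (LinearMap.range jet).topologicalClosure fun f =>
      Submodule.le_topologicalClosure _ (LinearMap.mem_range_self _ f)) := by
    intro u
    rw [closure_subtype, ← range_comp]
    exact u.2
  exact h

theorem n2_dS_le (f : 𝓢(ℝ, ℂ)) {j : ℕ} (hj : j < 4) : n2 ((dS ^ j) f) ≤ ‖toH3 f‖ :=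
  norm_le_pi_norm (jet f) ⟨j, hj⟩

theorem norm_toH3_le {f : 𝓢(ℝ, ℂ)} {C : ℝ} (hC : 0 ≤ C) (h : ∀ j < 4, n2 ((dS ^ j) f) ≤ C) :
    ‖toH3 f‖ ≤ C :=
  (pi_norm_le_iff_of_nonneg hC).2 fun j => h j j.2

/-- The Sobolev inequality uses the derivative j + 1, hence j < 3. It yields the constant √2,
rounded up to 2. -/
theorem norm_dS_le (f : 𝓢(ℝ, ℂ)) {j : ℕ} (hj : j < 3) (x : ℝ) :
    ‖(dS ^ j) f x‖ ≤ 2 * ‖toH3 f‖ := by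
  have h1 := norm_sq_le_n2 ((dS ^ j) f) x
  have h2 := n2_dS_le f (show j < 4 by omega)
  have h3 := n2_dS_le f (show j + 1 < 4 by omega)
  rw [pow_succ', mul_apply_eq_comp] at h3
  have h4 := n2_nonneg ((dS ^ j) f)
  have h5 := n2_nonneg (dS ((dS ^ j) f))
  refine abs_le_of_sq_le_sq' ?_ (by positivity) |>.2
  nlinarith

/-- The product of Schwartz functions. -/
abbrev mulS (f g : 𝓢(ℝ, ℂ)) : 𝓢(ℝ, ℂ) := SchwartzMap.pairing (ContinuousLinearMap.mul ℂ ℂ) f g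

theorem mulS_apply (f g : 𝓢(ℝ, ℂ)) (x : ℝ) : mulS f g x = f x * g x := rfl

theorem dS_mulS (f g : 𝓢(ℝ, ℂ)) : dS (mulS f g) = mulS (dS f) g + mulS f (dS g) := by
  ext x
  simp only [SchwartzMap.derivCLM_apply, add_apply, mulS_apply]
  exact ((f.hasDerivAt x).mul (g.hasDerivAt x)).deriv

theorem n2_mulS_le {f g : 𝓢(ℝ, ℂ)} {R : ℝ} (h : ∀ x, ‖f x‖ ≤ R) : n2 (mulS f g) ≤ R * n2 g :=
  n2_le_mul fun x => by rw [mulS_apply, norm_mul]; gcongr; exact h x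

theorem mulS_comm (f g : 𝓢(ℝ, ℂ)) : mulS f g = mulS g f := by
  ext x; simp only [mulS_apply]; ring

/-- By Leibniz the j-th derivative is a sum of 2^j products, at most 8 for j ≤ 3. -/
theorem n2_dS_mulS_le {f g : 𝓢(ℝ, ℂ)} {C : ℝ} (h : ∀ i j, i + j < 4 →
    n2 (mulS ((dS ^ i) f) ((dS ^ j) g)) ≤ C) : ‖toH3 (mulS f g)‖ ≤ 8 * C := by
  have hC : 0 ≤ C := (n2_nonneg _).trans (h 0 0 (by norm_num))
  refine norm_toH3_le (by positivity) fun j hj => ?_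
  have hs : ∀ n : ℕ, (dS ^ (n + 1)) = dS * dS ^ n := fun n => pow_succ' _ _
  have key : ∀ (i j : ℕ), dS (mulS ((dS ^ i) f) ((dS ^ j) g))
      = mulS ((dS ^ (i + 1)) f) ((dS ^ j) g) + mulS ((dS ^ i) f) ((dS ^ (j + 1)) g) := fun i j => by
    rw [dS_mulS, hs, hs]; rfl
  have e0 : mulS f g = mulS ((dS ^ 0) f) ((dS ^ 0) g) := rfl
  have t3 : ∀ F G : 𝓢(ℝ, ℂ), ∀ A B : ℝ, n2 F ≤ A → n2 G ≤ B → n2 (F + G) ≤ A + B :=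
    fun F G A B hA hB => (n2_add_le F G).trans (add_le_add hA hB)
  rw [e0]
  interval_cases j
  · rw [pow_zero]
    refine (h 0 0 (by norm_num)).trans (by linarith)
  · rw [pow_one, key]
    exact (t3 _ _ _ _ (h _ _ (by norm_num)) (h _ _ (by norm_num))).trans (by linarith)
  · rw [pow_succ, pow_one, mul_apply_eq_comp, key, map_add, key, key]
    exact (t3 _ _ _ _ (t3 _ _ _ _ (h _ _ (by norm_num)) (h _ _ (by norm_num)))
      (t3 _ _ _ _ (h _ _ (by norm_num)) (h _ _ (by norm_num)))).trans (by linarith)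
  · rw [pow_succ, pow_succ, pow_one, mul_apply_eq_comp, mul_apply_eq_comp,
      key, map_add, key, key, map_add, map_add, map_add, key, key, key]
    refine (t3 _ _ _ _ (t3 _ _ _ _ (t3 _ _ _ _ (h _ _ (by norm_num)) (h _ _ (by norm_num)))
      (t3 _ _ _ _ (h _ _ (by norm_num)) (h _ _ (by norm_num))))
      (t3 _ _ _ _ (t3 _ _ _ _ (h _ _ (by norm_num)) (h _ _ (by norm_num)))
      (t3 _ _ _ _ (h _ _ (by norm_num)) (h _ _ (by norm_num))))).trans (by linarith)

/-- Here f enters through sup norms of its derivatives, which decay like t^{-1/2} for an approximate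
solution, whereas its H³ norm does not decay. -/
theorem norm_toH3_mulS_le_of_bound {f : 𝓢(ℝ, ℂ)} (g : 𝓢(ℝ, ℂ)) {R : ℝ}
    (h : ∀ j < 4, ∀ x, ‖(dS ^ j) f x‖ ≤ R) : ‖toH3 (mulS f g)‖ ≤ 8 * R * ‖toH3 g‖ := by
  have hR : 0 ≤ R := (norm_nonneg _).trans (h 0 (by norm_num) 0)
  rw [mul_assoc]
  refine n2_dS_mulS_le fun i j hij => (n2_mulS_le (h i (by omega))).trans ?_
  gcongr
  exact n2_dS_le g (by omega)

/-- H³ is an algebra: when i + j ≤ 3 at most one index equals 3, so the other factor is bounded by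
Sobolev. The constant is 8 terms times 2. -/
theorem norm_toH3_mulS_le (f g : 𝓢(ℝ, ℂ)) : ‖toH3 (mulS f g)‖ ≤ 16 * ‖toH3 f‖ * ‖toH3 g‖ := by
  rw [show 16 * ‖toH3 f‖ * ‖toH3 g‖ = 8 * (2 * ‖toH3 f‖ * ‖toH3 g‖) by ring]
  refine n2_dS_mulS_le fun i j hij => ?_
  rcases Nat.lt_or_ge i 3 with hi | hi
  · refine (n2_mulS_le (norm_dS_le f hi)).trans ?_
    gcongr
    exact n2_dS_le g (by omega)
  · rw [mulS_comm]
    refine (n2_mulS_le (norm_dS_le g (show j < 3 by omega))).trans ?_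
    rw [mul_right_comm]
    gcongr
    exact n2_dS_le f (by omega)

/-- The complex conjugate of a Schwartz function. -/
def conjS (f : 𝓢(ℝ, ℂ)) : 𝓢(ℝ, ℂ) :=
  SchwartzMap.postcompCLM (𝕜 := ℝ) (Complex.conjCLE : ℂ →L[ℝ] ℂ) f

theorem conjS_apply (f : 𝓢(ℝ, ℂ)) (x : ℝ) : conjS f x = conj (f x) := by simp [conjS]

theorem dS_conjS (f : 𝓢(ℝ, ℂ)) : dS (conjS f) = conjS (dS f) := by
  ext x
  rw [conjS_apply, SchwartzMap.derivCLM_apply, SchwartzMap.derivCLM_apply]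
  have h : HasDerivAt (fun y => conj (f y)) (conj (deriv f x)) x :=
    (Complex.conjCLE : ℂ →L[ℝ] ℂ).hasFDerivAt.comp_hasDerivAt x (f.hasDerivAt x)
  rw [← h.deriv]
  congr 1

theorem n2_conjS (f : 𝓢(ℝ, ℂ)) : n2 (conjS f) = n2 f :=
  n2_congr fun x => by rw [conjS_apply, RCLike.norm_conj]

theorem dS_pow_conjS (f : 𝓢(ℝ, ℂ)) (j : ℕ) : (dS ^ j) (conjS f) = conjS ((dS ^ j) f) := by
  induction j with
  | zero => rfl
  | succ j ih =>
    rw [pow_succ', mul_apply_eq_comp, mul_apply_eq_comp, ih, dS_conjS]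

theorem norm_toH3_conjS (f : 𝓢(ℝ, ℂ)) : ‖toH3 (conjS f)‖ ≤ 1 * ‖toH3 f‖ := by
  rw [one_mul]
  refine norm_toH3_le (norm_nonneg _) fun j hj => ?_
  rw [dS_pow_conjS, n2_conjS]
  exact n2_dS_le f hj

end

section

/-! ### The free Schrödinger group -/

theorem iteratedDeriv_cexp_I (n : ℕ) :
    iteratedDeriv n (fun x : ℝ => Complex.exp (Complex.I * x))
      = fun x : ℝ => Complex.I ^ n * Complex.exp (Complex.I * x) := by
  induction n with
  | zero => simp
  | succ n ih =>
    rw [iteratedDeriv_succ, ih]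
    funext x
    have h : HasDerivAt (fun x : ℝ => Complex.exp (Complex.I * x))
        (Complex.exp (Complex.I * x) * (Complex.I * 1)) x :=
      ((hasDerivAt_id x).ofReal_comp.const_mul Complex.I).cexp
    rw [(h.const_mul _).deriv]; ring

theorem norm_cexp_I_mul (x : ℝ) : ‖Complex.exp (Complex.I * x)‖ = 1 := by
  rw [mul_comm]; exact Complex.norm_exp_ofReal_mul_I x

theorem hasTemperateGrowth_cexp_I :
    (fun x : ℝ => Complex.exp (Complex.I * x)).HasTemperateGrowth := by
  refine ⟨(contDiff_const.mul Complex.ofRealCLM.contDiff).cexp, fun n => ⟨0, 1, fun x => ?_⟩⟩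
  rw [norm_iteratedFDeriv_eq_norm_iteratedDeriv, iteratedDeriv_cexp_I]
  simp

theorem hasTemperateGrowth_cexp {p : ℝ → ℝ} (hp : p.HasTemperateGrowth) :
    (fun x : ℝ => Complex.exp (Complex.I * (p x : ℝ))).HasTemperateGrowth :=
  Function.HasTemperateGrowth.comp (g := fun x : ℝ => Complex.exp (Complex.I * x))
    hasTemperateGrowth_cexp_I hp

/-- The symbol `e^{-it(2πξ)²}` of the Schrödinger group. -/
def symb (t ξ : ℝ) : ℂ := Complex.exp (Complex.I * ((-t * (2 * Real.pi * ξ) ^ 2 : ℝ) : ℂ))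

theorem hasTemperateGrowth_symb (t : ℝ) : (symb t).HasTemperateGrowth :=
  hasTemperateGrowth_cexp (p := fun ξ => -t * (2 * Real.pi * ξ) ^ 2) (by fun_prop)

theorem norm_symb (t ξ : ℝ) : ‖symb t ξ‖ = 1 := norm_cexp_I_mul _

open FourierTransform

/-- The Schrödinger group `e^{it∂²}` on Schwartz functions. -/
def schr (t : ℝ) : 𝓢(ℝ, ℂ) →L[ℂ] 𝓢(ℝ, ℂ) := SchwartzMap.fourierMultiplierCLM ℂ (symb t)

theorem fourier_schr (t : ℝ) (f : 𝓢(ℝ, ℂ)) (ξ : ℝ) : 𝓕 (schr t f) ξ = symb t ξ * 𝓕 f ξ := by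
  rw [schr, SchwartzMap.fourierMultiplierCLM_apply, FourierTransform.fourier_fourierInv_eq,
    SchwartzMap.smulLeftCLM_apply_apply (hasTemperateGrowth_symb t), smul_eq_mul]

theorem fourier_dS (f : 𝓢(ℝ, ℂ)) (ξ : ℝ) : 𝓕 (dS f) ξ = 2 * Real.pi * Complex.I * ξ * 𝓕 f ξ := by
  have h : dS f = LineDeriv.lineDerivOp (1 : ℝ) f := by
    ext x
    rfl
  have hg : (fun ξ : ℝ => inner ℝ ξ (1 : ℝ)).HasTemperateGrowth := by fun_prop
  rw [h, SchwartzMap.fourier_lineDerivOp_eq, smul_apply,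
    SchwartzMap.smulLeftCLM_apply_apply hg]
  simp [mul_assoc]

theorem n2_fourier (f : 𝓢(ℝ, ℂ)) : n2 (𝓕 f) = n2 f := SchwartzMap.norm_fourier_toL2_eq f

theorem fourier_ext {f g : 𝓢(ℝ, ℂ)} (h : ∀ ξ, 𝓕 f ξ = 𝓕 g ξ) : f = g := by
  have := congrArg (fun F : 𝓢(ℝ, ℂ) => (𝓕⁻ F : 𝓢(ℝ, ℂ))) (SchwartzMap.ext h : 𝓕 f = 𝓕 g)
  simpa using this

theorem n2_schr (t : ℝ) (f : 𝓢(ℝ, ℂ)) : n2 (schr t f) = n2 f := by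
  rw [← n2_fourier, ← n2_fourier f]
  exact n2_congr fun ξ => by rw [fourier_schr, norm_mul, norm_symb, one_mul]

theorem dS_schr (t : ℝ) (f : 𝓢(ℝ, ℂ)) : dS (schr t f) = schr t (dS f) :=
  fourier_ext fun ξ => by simp only [fourier_dS, fourier_schr]; ring

theorem dS_pow_schr (t : ℝ) (f : 𝓢(ℝ, ℂ)) (j : ℕ) : (dS ^ j) (schr t f) = schr t ((dS ^ j) f) := by
  induction j with
  | zero => rfl
  | succ j ih => rw [pow_succ', mul_apply_eq_comp, mul_apply_eq_comp, ih, dS_schr]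

theorem norm_toH3_schr (t : ℝ) (f : 𝓢(ℝ, ℂ)) : ‖toH3 (schr t f)‖ ≤ 1 * ‖toH3 f‖ := by
  rw [one_mul]
  refine norm_toH3_le (norm_nonneg _) fun j hj => ?_
  rw [dS_pow_schr, n2_schr]
  exact n2_dS_le f hj

theorem symb_add (t s ξ : ℝ) : symb (t + s) ξ = symb t ξ * symb s ξ := by
  rw [symb, symb, symb, ← Complex.exp_add]; congr 1; push_cast; ring

theorem schr_schr (t s : ℝ) (f : 𝓢(ℝ, ℂ)) : schr t (schr s f) = schr (t + s) f :=
  fourier_ext fun ξ => by simp only [fourier_schr, symb_add]; ring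

theorem schr_zero (f : 𝓢(ℝ, ℂ)) : schr 0 f = f :=
  fourier_ext fun ξ => by simp [fourier_schr, symb]

theorem norm_cexp_sub_le (θ : ℝ) :
    ‖Complex.exp (Complex.I * θ) - 1 - Complex.I * θ‖ ≤ θ ^ 2 := by
  have hd : ∀ x : ℝ, HasDerivAt (fun x : ℝ => Complex.exp (Complex.I * x) - 1 - Complex.I * x)
      (Complex.I * (Complex.exp (Complex.I * x) - 1)) x := fun x => by
    have h1 : HasDerivAt (fun x : ℝ => Complex.I * (x : ℂ)) (Complex.I * 1) x :=
      (hasDerivAt_id x).ofReal_comp.const_mul Complex.I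
    exact ((h1.cexp.sub_const 1).sub h1).congr_deriv (by ring)
  have hb : ∀ x ∈ uIcc 0 θ, ‖Complex.I * (Complex.exp (Complex.I * x) - 1)‖ ≤ |θ| := fun x hx => by
    rw [norm_mul, Complex.norm_I, one_mul]
    refine (Real.norm_exp_I_mul_ofReal_sub_one_le (x := x)).trans ?_
    rw [Real.norm_eq_abs]
    have := abs_sub_left_of_mem_uIcc hx
    simpa using this
  have := (convex_uIcc (0 : ℝ) θ).norm_image_sub_le_of_norm_hasDerivWithin_le
    (fun x _ => (hd x).hasDerivWithinAt) hb left_mem_uIcc right_mem_uIcc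
  simpa [← sq] using this

theorem norm_symb_add_sub_le (t h ξ : ℝ) :
    ‖symb (t + h) ξ - symb t ξ + h * Complex.I * (2 * Real.pi * ξ) ^ 2 * symb t ξ‖
      ≤ h ^ 2 * ((2 * Real.pi * ξ) ^ 2) ^ 2 := by
  have := norm_cexp_sub_le (-h * (2 * Real.pi * ξ) ^ 2)
  rw [symb_add, show symb t ξ * symb h ξ - symb t ξ
    + h * Complex.I * (2 * Real.pi * ξ) ^ 2 * symb t ξ = symb t ξ * (symb h ξ - 1
      - Complex.I * ((-h * (2 * Real.pi * ξ) ^ 2 : ℝ) : ℂ)) by push_cast; ring, norm_mul,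
    norm_symb, one_mul]
  refine this.trans (le_of_eq (by ring))

/-- On the Fourier side this is the second-order Taylor remainder of e^{-it(2πξ)²}, bounded by
h²(2πξ)⁴, so it costs four derivatives. -/
theorem n2_schr_sub_le (t h : ℝ) (f : 𝓢(ℝ, ℂ)) :
    n2 (schr (t + h) f - schr t f - ((h : ℂ) * Complex.I) • schr t ((dS ^ 2) f))
      ≤ h ^ 2 * n2 ((dS ^ 4) f) := by
  rw [← n2_fourier, ← n2_fourier ((dS ^ 4) f)]
  refine n2_le_mul fun ξ => ?_
  have e2 : ∀ g : 𝓢(ℝ, ℂ), 𝓕 (dS (dS g)) ξ = -(2 * Real.pi * ξ) ^ 2 * 𝓕 g ξ := fun g => by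
    rw [fourier_dS, fourier_dS]
    linear_combination (2 * Real.pi * ξ) ^ 2 * 𝓕 g ξ * Complex.I_sq
  have e2' : 𝓕 ((dS ^ 2) f) ξ = -(2 * Real.pi * ξ) ^ 2 * 𝓕 f ξ := by
    rw [← e2]; rfl
  have e4 : 𝓕 ((dS ^ 4) f) ξ = ((2 * Real.pi * ξ) ^ 2) ^ 2 * 𝓕 f ξ := by
    rw [show (dS ^ 4) f = dS (dS ((dS ^ 2) f)) from rfl, e2, e2']; ring
  rw [show 𝓕 (schr (t + h) f - schr t f - ((h : ℂ) * Complex.I) • schr t ((dS ^ 2) f)) ξ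
    = (symb (t + h) ξ - symb t ξ + h * Complex.I * (2 * Real.pi * ξ) ^ 2 * symb t ξ) * 𝓕 f ξ by
      rw [← FourierTransform.fourierCLM_apply (R := ℂ), map_sub, map_sub, map_smul]
      simp only [FourierTransform.fourierCLM_apply, sub_apply, smul_apply, fourier_schr, e2',
        smul_eq_mul]
      ring, e4, norm_mul, norm_mul, ← mul_assoc,
    show ((2 * (Real.pi : ℂ) * ξ) ^ 2) ^ 2 = (((2 * Real.pi * ξ) ^ 2) ^ 2 : ℝ) by push_cast; ring,
    Complex.norm_real, Real.norm_of_nonneg (by positivity)]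
  exact mul_le_mul_of_nonneg_right (norm_symb_add_sub_le t h ξ) (norm_nonneg _)

theorem hasDerivAt_schr (t : ℝ) (f : 𝓢(ℝ, ℂ)) :
    HasDerivAt (fun t => toH3 (schr t f)) (Complex.I • toH3 (schr t ((dS ^ 2) f))) t := by
  have hb : ∀ h : ℝ, ‖toH3 (schr (t + h) f) - toH3 (schr t f)
      - h • (Complex.I • toH3 (schr t ((dS ^ 2) f)))‖ ≤ h ^ 2 * ‖toH3 ((dS ^ 4) f)‖ := fun h => by
    rw [← Complex.coe_smul, smul_smul, ← map_smul, ← map_sub, ← map_sub]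
    refine norm_toH3_le (by positivity) fun j hj => ?_
    have hc : ∀ n, (dS ^ j) ((dS ^ n) f) = (dS ^ n) ((dS ^ j) f) := fun n => by
      rw [← mul_apply_eq_comp, ← mul_apply_eq_comp, ← pow_add, ← pow_add, add_comm]
    rw [map_sub, map_sub, map_smul, dS_pow_schr, dS_pow_schr, dS_pow_schr, hc]
    refine (n2_schr_sub_le t h _).trans ?_
    rw [← hc]
    gcongr
    exact n2_dS_le _ hj
  rw [hasDerivAt_iff_isLittleO_nhds_zero]
  refine Asymptotics.IsBigO.trans_isLittleO (g := fun h : ℝ => h ^ 2) ?_ ?_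
  · refine Asymptotics.IsBigO.of_bound ‖toH3 ((dS ^ 4) f)‖ (.of_forall fun h => ?_)
    refine (hb h).trans (le_of_eq ?_)
    rw [Real.norm_of_nonneg (sq_nonneg h), mul_comm]
  · simpa using Asymptotics.isLittleO_pow_id (𝕜 := ℝ) (n := 2) (by norm_num)

end

section

/-! ### Operators on `H³` -/

theorem H3.exists_seq (u : H3) :
    ∃ f : ℕ → 𝓢(ℝ, ℂ), Filter.Tendsto (fun n => toH3 (f n)) Filter.atTop (nhds u) := by
  obtain ⟨v, hv, hu⟩ := mem_closure_iff_seq_limit.1 (denseRange_toH3 u)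
  choose f hf using hv
  exact ⟨f, by simpa only [hf] using hu⟩

/-- Identities between continuous maps on H³ need checking on Schwartz functions only, where they
are pointwise. -/
theorem H3.induction {P : H3 → Prop} (closed : IsClosed {u | P u}) (mem : ∀ f, P (toH3 f))
    (u : H3) : P u :=
  denseRange_toH3.induction_on u closed mem

/-- Multiplication by a Schwartz function on `H³`. -/
def mulL (f : 𝓢(ℝ, ℂ)) : H3 →L[ℂ] H3 :=
  (toH3 ∘ₗ (SchwartzMap.pairing (ContinuousLinearMap.mul ℂ ℂ) f).toLinearMap).extendOfNorm toH3

theorem mulL_toH3 (f g : 𝓢(ℝ, ℂ)) : mulL f (toH3 g) = toH3 (mulS f g) :=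
  LinearMap.extendOfNorm_eq denseRange_toH3 ⟨_, fun g => norm_toH3_mulS_le f g⟩ g

theorem norm_mulL_le (f : 𝓢(ℝ, ℂ)) : ‖mulL f‖ ≤ 16 * ‖toH3 f‖ :=
  LinearMap.opNorm_extendOfNorm_le denseRange_toH3 (by positivity) fun g => norm_toH3_mulS_le f g

theorem norm_mulL_le_of_bound {f : 𝓢(ℝ, ℂ)} {R : ℝ} (h : ∀ j < 4, ∀ x, ‖(dS ^ j) f x‖ ≤ R) :
    ‖mulL f‖ ≤ 8 * R :=
  LinearMap.opNorm_extendOfNorm_le denseRange_toH3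
    (by have := (norm_nonneg _).trans (h 0 (by norm_num) 0); positivity)
    fun g => norm_toH3_mulS_le_of_bound g h

/-- `mulL` as a linear map. -/
def mulLM : 𝓢(ℝ, ℂ) →ₗ[ℂ] H3 →L[ℂ] H3 where
  toFun := mulL
  map_add' f g := by
    ext u : 1
    induction u using H3.induction with
    | closed => exact isClosed_eq (by fun_prop) (by fun_prop)
    | mem h =>
      simp only [add_apply, mulL_toH3, mulS, map_add]
  map_smul' c f := by
    ext u : 1
    induction u using H3.induction with
    | closed => exact isClosed_eq (by fun_prop) (by fun_prop)
    | mem h =>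
      simp only [smul_apply, mulL_toH3, mulS, map_smul, RingHom.id_apply]

/-- The product on `H³`. -/
def mulH : H3 →L[ℂ] H3 →L[ℂ] H3 := mulLM.extendOfNorm toH3

theorem mulH_toH3_left (f : 𝓢(ℝ, ℂ)) : mulH (toH3 f) = mulL f :=
  LinearMap.extendOfNorm_eq denseRange_toH3 ⟨_, norm_mulL_le⟩ f

theorem mulH_toH3 (f g : 𝓢(ℝ, ℂ)) : mulH (toH3 f) (toH3 g) = toH3 (mulS f g) := by
  rw [mulH_toH3_left, mulL_toH3]

theorem norm_mulH_le (u : H3) : ‖mulH u‖ ≤ 16 * ‖u‖ :=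
  LinearMap.norm_extendOfNorm_apply_le denseRange_toH3 16 norm_mulL_le u

theorem mulH_comm (u v : H3) : mulH u v = mulH v u := by
  induction u using H3.induction with
  | closed => exact isClosed_eq (by fun_prop) (by fun_prop)
  | mem f =>
    induction v using H3.induction with
    | closed => exact isClosed_eq (by fun_prop) (by fun_prop)
    | mem g =>
      rw [mulH_toH3, mulH_toH3, mulS_comm]

theorem mulH_assoc (u v w : H3) : mulH (mulH u v) w = mulH u (mulH v w) := by
  induction u using H3.induction with
  | closed => exact isClosed_eq (by fun_prop) (by fun_prop)
  | mem f =>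
    induction v using H3.induction with
    | closed => exact isClosed_eq (by fun_prop) (by fun_prop)
    | mem g =>
      induction w using H3.induction with
      | closed => exact isClosed_eq (by fun_prop) (by fun_prop)
      | mem h =>
        simp only [mulH_toH3]
        congr 1
        ext x
        simp only [mulS_apply, mul_assoc]

/-- Complex conjugation of Schwartz functions, as a semilinear map to `H³`. -/
def conjLM : 𝓢(ℝ, ℂ) →ₛₗ[starRingEnd ℂ] H3 where
  toFun f := toH3 (conjS f)
  map_add' f g := by rw [← map_add]; congr 1; ext x; simp [conjS_apply]
  map_smul' c f := by rw [← map_smul]; congr 1; ext x; simp [conjS_apply]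

/-- Complex conjugation on `H³`. -/
def conjH : H3 →L⋆[ℂ] H3 := conjLM.extendOfNorm toH3

theorem conjH_toH3 (f : 𝓢(ℝ, ℂ)) : conjH (toH3 f) = toH3 (conjS f) :=
  LinearMap.extendOfNorm_eq denseRange_toH3 ⟨_, norm_toH3_conjS⟩ f

theorem norm_conjH_le (u : H3) : ‖conjH u‖ ≤ ‖u‖ := 
  (LinearMap.norm_extendOfNorm_apply_le denseRange_toH3 1 norm_toH3_conjS u).trans_eq (one_mul _)

theorem conjH_mulH (u v : H3) : conjH (mulH u v) = mulH (conjH u) (conjH v) := by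
  induction u using H3.induction with
  | closed => exact isClosed_eq (by fun_prop) (by fun_prop)
  | mem f =>
    induction v using H3.induction with
    | closed => exact isClosed_eq (by fun_prop) (by fun_prop)
    | mem g =>
      simp only [mulH_toH3, conjH_toH3]
      congr 1
      ext x
      simp only [mulS_apply, conjS_apply, map_mul]

theorem conjH_conjH (u : H3) : conjH (conjH u) = u := by
  induction u using H3.induction with
  | closed => exact isClosed_eq (by fun_prop) (by fun_prop)
  | mem f =>
    simp only [conjH_toH3]
    congr 1
    ext x
    simp only [conjS_apply, Complex.conj_conj]

/-- Because ūv is the conjugate of u v̄. Multiplier norms, rather than ‖u‖, carry the decay in the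
nonlinear estimates, so they need their own conjugation bound. -/
theorem norm_mulH_conjH_le (u : H3) : ‖mulH (conjH u)‖ ≤ ‖mulH u‖ :=
  ContinuousLinearMap.opNorm_le_bound _ (norm_nonneg _) fun v => by
    rw [← conjH_conjH v, ← conjH_mulH, conjH_conjH]
    refine (norm_conjH_le _).trans (((mulH u).le_opNorm _).trans ?_)
    gcongr
    exact norm_conjH_le v

/-- The Schrödinger group on `H³`. -/
def schrH (t : ℝ) : H3 →L[ℂ] H3 := (toH3 ∘ₗ (schr t).toLinearMap).extendOfNorm toH3

theorem schrH_toH3 (t : ℝ) (f : 𝓢(ℝ, ℂ)) : schrH t (toH3 f) = toH3 (schr t f) :=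
  LinearMap.extendOfNorm_eq denseRange_toH3 ⟨_, norm_toH3_schr t⟩ f

theorem norm_schrH_le (t : ℝ) (u : H3) : ‖schrH t u‖ ≤ ‖u‖ := 
  (LinearMap.norm_extendOfNorm_apply_le denseRange_toH3 1 (norm_toH3_schr t) u).trans_eq (one_mul _)

theorem schrH_schrH (t s : ℝ) (u : H3) : schrH t (schrH s u) = schrH (t + s) u := by
  induction u using H3.induction with
  | closed => exact isClosed_eq (by fun_prop) (by fun_prop)
  | mem f =>
    simp only [schrH_toH3, schr_schr]

theorem schrH_zero (u : H3) : schrH 0 u = u := by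
  induction u using H3.induction with
  | closed => exact isClosed_eq (by fun_prop) (by fun_prop)
  | mem f =>
    rw [schrH_toH3, schr_zero]

theorem norm_schrH (t : ℝ) (u : H3) : ‖schrH t u‖ = ‖u‖ :=
  le_antisymm (norm_schrH_le t u) <| by
    simpa [schrH_schrH, schrH_zero] using norm_schrH_le (-t) (schrH t u)

/-- For Schwartz data the orbit is differentiable in H³; since the group is isometric, approximation
of the data is uniform in t, and continuity passes to the limit. -/
theorem continuous_schrH_apply (u : H3) : Continuous fun t => schrH t u := by
  refine continuous_of_uniform_approx_of_continuous fun W hW => ?_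
  obtain ⟨ε, hε, hW⟩ := Metric.mem_uniformity_dist.1 hW
  obtain ⟨f, hf⟩ := denseRange_toH3.exists_dist_lt u hε
  refine ⟨fun t => schrH t (toH3 f), ?_, fun t => hW ?_⟩
  · simp only [schrH_toH3]
    exact continuous_iff_continuousAt.2 fun t => (hasDerivAt_schr t f).continuousAt
  · rw [dist_eq_norm, ← map_sub, norm_schrH, ← dist_eq_norm]; exact hf

theorem continuous_schrH : Continuous fun p : ℝ × H3 => schrH p.1 p.2 :=
  continuous_prod_of_continuous_lipschitzWith' _ 1
    (fun t => LipschitzWith.of_dist_le_mul fun u v => by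
      simp only [dist_eq_norm, ← map_sub, norm_schrH]; simp)
    continuous_schrH_apply

/-- The `j`-th derivative at `x` of a Schwartz function, as a linear map. -/
def evLM (j : ℕ) (x : ℝ) : 𝓢(ℝ, ℂ) →ₗ[ℂ] ℂ where
  toFun f := (dS ^ j) f x
  map_add' f g := by simp
  map_smul' c f := by simp

/-- The `j`-th derivative at `x` of an element of `H³`, for `j ≤ 2`. -/
def ev (j : ℕ) (x : ℝ) : H3 →L[ℂ] ℂ := (evLM j x).extendOfNorm toH3

theorem ev_toH3 {j : ℕ} (hj : j < 3) (x : ℝ) (f : 𝓢(ℝ, ℂ)) : ev j x (toH3 f) = (dS ^ j) f x :=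
  LinearMap.extendOfNorm_eq denseRange_toH3 ⟨2, fun f => norm_dS_le f hj x⟩ f

theorem norm_ev_le {j : ℕ} (hj : j < 3) (x : ℝ) (u : H3) : ‖ev j x u‖ ≤ 2 * ‖u‖ :=
  LinearMap.norm_extendOfNorm_apply_le denseRange_toH3 2 (fun f => norm_dS_le f hj x) u

theorem tendstoUniformly_ev {j : ℕ} (hj : j < 3) {v : ℕ → H3} {u : H3}
    (h : Filter.Tendsto v Filter.atTop (nhds u)) :
    TendstoUniformly (fun n x => ev j x (v n)) (fun x => ev j x u) Filter.atTop := by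
  rw [Metric.tendstoUniformly_iff]
  intro ε hε
  filter_upwards [Metric.tendsto_nhds.1 h (ε / 2) (by positivity)] with n hn x
  rw [dist_eq_norm, ← map_sub]
  refine (norm_ev_le hj x _).trans_lt ?_
  rw [← dist_eq_norm, dist_comm]
  linarith

theorem hasDerivAt_ev {j : ℕ} (hj : j < 2) (u : H3) (x : ℝ) :
    HasDerivAt (fun x => ev j x u) (ev (j + 1) x u) x := by
  obtain ⟨f, hf⟩ := H3.exists_seq u
  refine hasDerivAt_of_tendstoUniformly (tendstoUniformly_ev (show j + 1 < 3 by omega) hf)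
    (f := fun n x => ev j x (toH3 (f n))) (.of_forall fun n x => ?_)
    (fun x => (tendstoUniformly_ev (show j < 3 by omega) hf).tendsto_at x) x
  simp only [ev_toH3 (show j < 3 by omega), ev_toH3 (show j + 1 < 3 by omega)]
  have := ((dS ^ j) (f n)).hasDerivAt x
  rw [pow_succ', mul_apply_eq_comp, SchwartzMap.derivCLM_apply]
  exact this

theorem continuous_ev_apply {j : ℕ} (hj : j < 3) (u : H3) : Continuous fun x => ev j x u := by
  obtain ⟨f, hf⟩ := H3.exists_seq u
  refine (tendstoUniformly_ev hj hf).continuous (.of_forall fun n => ?_)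
  simp only [ev_toH3 hj]
  exact ((dS ^ j) (f n)).continuous

theorem continuous_ev {j : ℕ} (hj : j < 3) : Continuous fun p : ℝ × H3 => ev j p.1 p.2 :=
  continuous_prod_of_continuous_lipschitzWith' _ 2
    (fun x => LipschitzWith.of_dist_le_mul fun u v => by
      simp only [dist_eq_norm, ← map_sub]; exact norm_ev_le hj x _)
    (continuous_ev_apply hj)

theorem contDiff_ev (u : H3) : ContDiff ℝ 2 fun x => ev 0 x u := by
  have h0 : deriv (fun x => ev 0 x u) = fun x => ev 1 x u :=
    funext fun x => (hasDerivAt_ev (by norm_num) u x).deriv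
  have h1 : deriv (fun x => ev 1 x u) = fun x => ev 2 x u :=
    funext fun x => (hasDerivAt_ev (by norm_num) u x).deriv
  rw [show (2 : WithTop ℕ∞) = 1 + 1 by norm_num, contDiff_succ_iff_deriv]
  refine ⟨fun x => (hasDerivAt_ev (by norm_num) u x).differentiableAt, by simp, ?_⟩
  rw [h0, contDiff_one_iff_deriv, h1]
  exact ⟨fun x => (hasDerivAt_ev (by norm_num) u x).differentiableAt,
    continuous_ev_apply (by norm_num) u⟩

/-- Fatou's lemma along Schwartz approximants, which converge pointwise together with these
derivatives. -/
theorem eLpNorm_ev_le {j : ℕ} (hj : j < 3) (u : H3) :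
    eLpNorm (fun x => ev j x u) 2 volume ≤ ENNReal.ofReal ‖u‖ := by
  obtain ⟨f, hf⟩ := H3.exists_seq u
  refine (Lp.eLpNorm_lim_le_liminf_eLpNorm (f := fun n x => ev j x (toH3 (f n)))
    (fun n => (continuous_ev_apply hj _).aestronglyMeasurable) _
    (.of_forall fun x => ((ev j x).continuous.tendsto u).comp hf)).trans ?_
  have h1 : Filter.Tendsto (fun n => ENNReal.ofReal ‖toH3 (f n)‖) Filter.atTop
      (nhds (ENNReal.ofReal ‖u‖)) := (ENNReal.continuous_ofReal.tendsto _).comp hf.norm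
  rw [← h1.liminf_eq]
  refine Filter.liminf_le_liminf (.of_forall fun n => ?_)
  simp only [ev_toH3 hj]
  rw [eLpNorm_eq_n2]
  exact ENNReal.ofReal_le_ofReal (n2_dS_le _ (by omega))

theorem ev_mulH (x : ℝ) (u v : H3) : ev 0 x (mulH u v) = ev 0 x u * ev 0 x v := by
  induction u using H3.induction with
  | closed => exact isClosed_eq (by fun_prop) (by fun_prop)
  | mem f =>
    induction v using H3.induction with
    | closed => exact isClosed_eq (by fun_prop) (by fun_prop)
    | mem g =>
      rw [mulH_toH3, ev_toH3 (by norm_num), ev_toH3 (by norm_num), ev_toH3 (by norm_num)]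
      rfl

theorem ev_conjH (x : ℝ) (u : H3) : ev 0 x (conjH u) = conj (ev 0 x u) := by
  induction u using H3.induction with
  | closed => exact isClosed_eq (by fun_prop) (by fun_prop)
  | mem f =>
    rw [conjH_toH3, ev_toH3 (by norm_num), ev_toH3 (by norm_num)]
    exact conjS_apply f x

/-- The orbit of a general u need not be differentiable in H³, but its point values are: ∂² followed
by evaluation is bounded on H³, so the time derivatives of Schwartz approximants converge uniformly
in t. -/
theorem hasDerivAt_ev_schrH (x : ℝ) (u : H3) (t : ℝ) :
    HasDerivAt (fun t => ev 0 x (schrH t u)) (Complex.I * ev 2 x (schrH t u)) t := by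
  obtain ⟨f, hf⟩ := H3.exists_seq u
  refine hasDerivAt_of_tendstoUniformly (l := Filter.atTop)
    (f := fun n t => ev 0 x (schrH t (toH3 (f n))))
    (f' := fun n t => Complex.I * ev 2 x (schrH t (toH3 (f n))))
    (g' := fun t => Complex.I * ev 2 x (schrH t u)) ?_ (.of_forall fun n t => ?_)
    (fun t => (show Continuous fun u => ev 0 x (schrH t u) by fun_prop).tendsto u |>.comp hf) t
  · rw [Metric.tendstoUniformly_iff]
    intro ε hε
    filter_upwards [Metric.tendsto_nhds.1 hf (ε / 2) (by positivity)] with n hn t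
    rw [dist_eq_norm, ← mul_sub, norm_mul, Complex.norm_I, one_mul, ← map_sub, ← map_sub]
    refine (norm_ev_le (by norm_num) x _).trans_lt ?_
    rw [norm_schrH, ← dist_eq_norm, dist_comm]
    linarith
  · simp only [schrH_toH3]
    have h1 := (ev 0 x).hasFDerivAt.restrictScalars ℝ |>.comp_hasDerivAt t
      (hasDerivAt_schr t (f n))
    refine h1.congr_deriv ?_
    simp only [ContinuousLinearMap.coe_restrictScalars', map_smul, smul_eq_mul]
    rw [ev_toH3 (by norm_num), ev_toH3 (by norm_num), pow_zero, dS_pow_schr]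
    rfl

/-- The free group turns a differentiable curve in `H³` into a classical solution of a forced
Schrödinger equation. -/
theorem hasDerivAt_ev_schrH_curve {z : ℝ → H3} {z' : H3} {t : ℝ} (hz : HasDerivAt z z' t) (x : ℝ) :
    HasDerivAt (fun t => ev 0 x (schrH t (z t)))
      (Complex.I * ev 2 x (schrH t (z t)) + ev 0 x (schrH t z')) t := by
  have h1 := hasDerivAt_ev_schrH x (z t) t
  rw [hasDerivAt_iff_tendsto_slope] at h1 hz ⊢
  have hid : Filter.Tendsto (fun τ : ℝ => τ) (nhdsWithin t {t}ᶜ) (nhds t) :=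
    nhdsWithin_le_nhds
  -- Product rule on slopes: the slope at t is that of τ ↦ e^{iτ∂²}z(t) plus e^{iτ∂²} applied to the
  -- slope of z. The second part converges by joint continuity of the group.
  have h2 := (((ev 0 x).continuous.comp continuous_schrH).tendsto (t, z')).comp
    (hid.prodMk_nhds hz)
  refine (h1.add h2).congr fun τ => ?_
  simp only [Function.comp_def, slope_def_module, ← Complex.coe_smul, map_smul, map_sub]
  rw [← smul_add]
  congr 1
  ring

end

section

/-! ### Profiles -/

variable {β γ : ℝ} {a b : 𝓢(ℝ, ℝ)} {k l m : ℕ} {f g h W W' V R : ℝ → ℝ → ℂ}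

/-- Joint differentiability is required for the chain rule along τ ↦ (τ, x/τ). -/
theorem Sym.differentiableAt (hW : Sym β a b k W) {s : ℝ} (hs : 0 < s) (y : ℝ) :
    DifferentiableAt ℝ (fun p : ℝ × ℝ => W p.1 p.2) (s, y) := by
  have hU : {p : ℝ × ℝ | 0 < p.1} ∈ nhds (s, y) :=
    (isOpen_lt continuous_const continuous_fst).mem_nhds hs
  induction hW with
  | zero h0 =>
    refine (differentiableAt_const (0 : ℂ)).congr_of_eventuallyEq ?_
    filter_upwards [hU] with p hp using h0 _ hp _
  | @cons W W' _ c k' j hk h1 ih =>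
    have e : (fun p : ℝ × ℝ => W' p.1 p.2) =ᶠ[nhds (s, y)]
        fun p => W p.1 p.2 + NLS.term β a b c k' j p.1 p.2 := by
      filter_upwards [hU] with p hp using h1 _ hp _
    refine (ih.add ?_).congr_of_eventuallyEq e
    have hs' : ((s, y) : ℝ × ℝ).1 ≠ 0 := hs.ne'
    have hlog : DifferentiableAt ℝ (fun p : ℝ × ℝ => Real.log p.1) (s, y) :=
      differentiableAt_fst.log hs'
    have hof : ∀ {F : ℝ × ℝ → ℝ}, DifferentiableAt ℝ F (s, y) →
        DifferentiableAt ℝ (fun p => (F p : ℂ)) (s, y) := fun {F} hF =>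
      (Complex.ofRealCLM.differentiableAt).comp (s, y) hF
    have hc : DifferentiableAt ℝ (fun p : ℝ × ℝ => c p.2) (s, y) :=
      (c.differentiable.comp differentiable_snd) _
    have ha : DifferentiableAt ℝ (fun p : ℝ × ℝ => a p.2) (s, y) :=
      (a.differentiable.comp differentiable_snd) _
    have hb : DifferentiableAt ℝ (fun p : ℝ × ℝ => b p.2) (s, y) :=
      (b.differentiable.comp differentiable_snd) _
    have ho : DifferentiableAt ℝ (fun p : ℝ × ℝ => osc β a b p.1 p.2) (s, y) :=
      ((hof ((((ha.pow 2).const_mul (-β)).mul hlog).add hb)).const_mul Complex.I).cexp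
    have hp : DifferentiableAt ℝ (fun p : ℝ × ℝ => (p.1 : ℂ) ^ k') (s, y) :=
      (hof differentiableAt_fst).pow k'
    have hp0 : ((s, y).1 : ℂ) ^ k' ≠ 0 := pow_ne_zero _ (by exact_mod_cast hs.ne')
    have hn : DifferentiableAt ℝ (fun p : ℝ × ℝ => osc β a b p.1 p.2 * (Real.log p.1 : ℂ) ^ j)
        (s, y) := ho.mul ((hof hlog).pow j)
    have hi := hn.fun_mul (hp.fun_inv hp0)
    exact hc.mul (by simpa only [div_eq_mul_inv] using hi)

theorem Sym.hasDerivAt_dilate (hW : Sym β a b k W) {t : ℝ} (ht : 0 < t) (x : ℝ) :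
    HasDerivAt (fun τ => W τ (x / τ)) (deriv (fun σ => W σ (x / t)) t
      - (x / t ^ 2 : ℝ) * deriv (fun η => W t η) (x / t)) t := by
  have hF := (hW.differentiableAt ht (x / t)).hasFDerivAt
  set D := fderiv ℝ (fun p : ℝ × ℝ => W p.1 p.2) (t, x / t)
  have h1 : deriv (fun σ => W σ (x / t)) t = D (1, 0) :=
    (hF.comp_hasDerivAt (f := fun σ => (σ, x / t)) t
      ((hasDerivAt_id t).prodMk (hasDerivAt_const t (x / t)))).deriv
  have h2 : deriv (fun η => W t η) (x / t) = D (0, 1) :=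
    (hF.comp_hasDerivAt (f := fun η => (t, η)) (x / t)
      ((hasDerivAt_const (x / t) t).prodMk (hasDerivAt_id (x / t)))).deriv
  have h3 : HasDerivAt (fun τ : ℝ => (τ, x / τ)) (1, -(x / t ^ 2)) t := by
    refine (hasDerivAt_id t).prodMk ?_
    refine ((hasDerivAt_const t x).div (hasDerivAt_id t) ht.ne').congr_deriv ?_
    simp only [id]; ring
  refine (hF.comp_hasDerivAt t h3).congr_deriv ?_
  rw [h1, h2, show ((1, -(x / t ^ 2)) : ℝ × ℝ) = (1, 0) - (x / t ^ 2) • (0, 1) by simp,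
    map_sub, map_smul, Complex.real_smul]

/-- The factor `t^{-1/2} e^{ix²/4t}`. -/
def chirp (t x : ℝ) : ℂ :=
  ((t ^ (-(1 / 2) : ℝ) : ℝ) : ℂ) * Complex.exp (Complex.I * ((x ^ 2 / (4 * t) : ℝ) : ℂ))

theorem ofProfile_eq (W : ℝ → ℝ → ℂ) (t x : ℝ) : ofProfile W t x = chirp t x * W t (x / t) := rfl

theorem norm_chirp {t : ℝ} (ht : 0 < t) (x : ℝ) : ‖chirp t x‖ = t ^ (-(1 / 2) : ℝ) := by
  rw [chirp, norm_mul, norm_cexp_I_mul, mul_one, Complex.norm_real,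
    Real.norm_of_nonneg (Real.rpow_nonneg ht.le _)]

theorem norm_chirp_sq {t : ℝ} (ht : 0 < t) (x : ℝ) : ‖chirp t x‖ ^ 2 = t⁻¹ := by
  rw [norm_chirp ht, ← Real.rpow_natCast, ← Real.rpow_mul ht.le]
  norm_num [Real.rpow_neg_one]

theorem hasDerivAt_chirp_x (t x : ℝ) :
    HasDerivAt (chirp t) (chirp t x * (Complex.I * x / (2 * t))) x := by
  have h1 : HasDerivAt (fun x : ℝ => x ^ 2 / (4 * t)) (2 * x / (4 * t)) x := by
    simpa using (hasDerivAt_pow 2 x).div_const (4 * t)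
  refine (((h1.ofReal_comp.const_mul Complex.I).cexp).const_mul _).congr_deriv ?_
  rw [chirp]; push_cast; ring

theorem hasDerivAt_chirp_t {t : ℝ} (ht : 0 < t) (x : ℝ) :
    HasDerivAt (fun τ => chirp τ x)
      (chirp t x * (-1 / (2 * t) - Complex.I * x ^ 2 / (4 * t ^ 2))) t := by
  have ht' : (t : ℂ) ≠ 0 := by exact_mod_cast ht.ne'
  have h1 : HasDerivAt (fun τ : ℝ => x ^ 2 / (4 * τ)) (-(x ^ 2 / (4 * t ^ 2))) t := by
    refine ((hasDerivAt_const t (x ^ 2)).div ((hasDerivAt_id t).const_mul 4)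
      (by simpa using ht.ne')).congr_deriv ?_
    simp only [id]; field_simp; ring
  have h2 : HasDerivAt (fun τ : ℝ => τ ^ (-(1 / 2) : ℝ)) (t ^ (-(1 / 2) : ℝ) * (-1 / (2 * t))) t := by
    refine (Real.hasDerivAt_rpow_const (Or.inl ht.ne')).congr_deriv ?_
    rw [Real.rpow_sub_one ht.ne']; ring
  refine (h2.ofReal_comp.mul ((h1.ofReal_comp.const_mul Complex.I).cexp)).congr_deriv ?_
  rw [chirp]; push_cast; ring

/-- The operator on profiles that corresponds to `∂_x`. -/
def Dx (W : ℝ → ℝ → ℂ) (s y : ℝ) : ℂ :=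
  Complex.I / 2 * y * W s y + deriv (fun η => W s η) y / (s : ℂ) ^ 1

/-- The operator on profiles that corresponds to `∂_t`. -/
def Dt (W : ℝ → ℝ → ℂ) (s y : ℝ) : ℂ :=
  (-1 / 2) * (W s y / (s : ℂ) ^ 1) - Complex.I / 4 * y ^ 2 * W s y
    + deriv (fun σ => W σ y) s - y * (deriv (fun η => W s η) y / (s : ℂ) ^ 1)

theorem hasTemperateGrowth_coe_id : (fun y : ℝ => (y : ℂ)).HasTemperateGrowth :=
  Function.Complex.hasTemperateGrowth_ofReal

/-- To leading order ∂_x acts on profiles as multiplication by iy/2, coming from the chirp;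
differentiating the profile itself costs 1/s. -/
theorem Sym.Dx_sub (hW : Sym β a b k W) :
    Sym β a b (k + 1) (fun s y => Dx W s y - Complex.I / 2 * y * W s y) :=
  (hW.deriv_y.div_pow 1).congr fun s _ y => by rw [Dx]; ring

theorem Sym.Dx (hW : Sym β a b k W) : Sym β a b k (Dx W) := by
  have h := hasTemperateGrowth_coe_id
  have hg : (fun y : ℝ => Complex.I / 2 * (y : ℂ)).HasTemperateGrowth := by fun_prop
  exact ((hW.temperate_mul hg).add ((hW.deriv_y.div_pow 1).mono (Nat.le_succ k)))

theorem Sym.Dt (hW : Sym β a b k W) : Sym β a b k (Dt W) := by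
  have h := hasTemperateGrowth_coe_id
  have hg : (fun y : ℝ => Complex.I / 4 * (y : ℂ) ^ 2).HasTemperateGrowth := by fun_prop
  exact (((((hW.div_pow 1).const_mul (-1 / 2)).mono (Nat.le_succ k)).sub
    (hW.temperate_mul hg)).add (hW.deriv_s.mono (Nat.le_succ k))).sub
    (((hW.deriv_y.div_pow 1).temperate_mul h).mono (Nat.le_succ k))

theorem Sym.hasDerivAt_ofProfile_x (hW : Sym β a b k W) {t : ℝ} (ht : 0 < t) (x : ℝ) :
    HasDerivAt (ofProfile W t) (ofProfile (NLS.Dx W) t x) x := by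
  have ht' : (t : ℂ) ≠ 0 := by exact_mod_cast ht.ne'
  have h1 : HasDerivAt (fun x => W t (x / t)) ((1 / t : ℝ) • deriv (W t) (x / t)) x :=
    ((hW.differentiable_y ht (x / t)).hasDerivAt).scomp x ((hasDerivAt_id x).div_const t)
  refine ((hasDerivAt_chirp_x t x).mul h1).congr_deriv ?_
  rw [ofProfile_eq, NLS.Dx, Complex.real_smul]
  push_cast
  field_simp

theorem Sym.hasDerivAt_ofProfile_t (hW : Sym β a b k W) {t : ℝ} (ht : 0 < t) (x : ℝ) :
    HasDerivAt (fun τ => ofProfile W τ x) (ofProfile (NLS.Dt W) t x) t := by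
  have ht' : (t : ℂ) ≠ 0 := by exact_mod_cast ht.ne'
  refine ((hasDerivAt_chirp_t ht x).mul (hW.hasDerivAt_dilate ht x)).congr_deriv ?_
  rw [ofProfile_eq, NLS.Dt]
  push_cast
  field_simp
  ring

/-- From |chirp|² = 1/t: this is the origin of β/s, and in the quintic case of γ/s², in Ψ. -/
theorem G₁_ofProfile {t : ℝ} (ht : 0 < t) (x : ℝ) (V : ℝ → ℝ → ℂ) :
    G₁ (ofProfile V t x) = chirp t x * ((1 / t : ℝ) * G₁ (V t (x / t))) := by
  rw [ofProfile_eq, G₁, G₁, norm_mul, ← Complex.ofReal_pow, mul_pow, norm_chirp_sq ht]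
  push_cast; ring

theorem G₂_ofProfile {t : ℝ} (ht : 0 < t) (x : ℝ) (V : ℝ → ℝ → ℂ) :
    G₂ (ofProfile V t x) = chirp t x * ((1 / t ^ 2 : ℝ) * G₂ (V t (x / t))) := by
  rw [ofProfile_eq, G₂, G₂, norm_mul, ← Complex.ofReal_pow, mul_pow,
    show ‖chirp t x‖ ^ 4 = (‖chirp t x‖ ^ 2) ^ 2 by ring, norm_chirp_sq ht]
  push_cast; ring

/-- The Schrödinger equation for `ofProfile V` in terms of the profile `V`. -/
theorem Sym.ofProfile_psi (hV : Sym β a b 0 V) {t : ℝ} (ht : 0 < t) (x : ℝ) :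
    Complex.I * ofProfile (NLS.Dt V) t x + ofProfile (NLS.Dx (NLS.Dx V)) t x
      - β * NLS.G₁ (ofProfile V t x) - γ * NLS.G₂ (ofProfile V t x)
      = ofProfile (Psi β γ V) t x := by
  have ht' : (t : ℂ) ≠ 0 := by exact_mod_cast ht.ne'
  set y := x / t with hy
  have hd : deriv (fun η => NLS.Dx V t η) y = Complex.I / 2 * V t y
      + Complex.I / 2 * y * deriv (fun η => V t η) y
      + iteratedDeriv 2 (fun η => V t η) y / (t : ℂ) := by
    have h1 := (hV.differentiable_y ht y).hasDerivAt
    have h2 := (hV.deriv_y.differentiable_y ht y).hasDerivAt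
    have h3 : HasDerivAt (fun η : ℝ => Complex.I / 2 * (η : ℂ)) (Complex.I / 2 * 1) y :=
      (hasDerivAt_id y).ofReal_comp.const_mul _
    refine (((h3.mul h1).add (h2.div_const ((t : ℂ) ^ 1)))).deriv.trans ?_
    rw [iteratedDeriv_succ, iteratedDeriv_one]
    ring
  rw [G₁_ofProfile ht, G₂_ofProfile ht, ofProfile_eq, ofProfile_eq, ofProfile_eq, ← hy,
    NLS.Dx, hd, NLS.Dx, NLS.Dt, Psi]
  push_cast
  field_simp
  ring

end

section

/-! ### Bounds for profiles -/

variable {β γ : ℝ} {a b : 𝓢(ℝ, ℝ)} {k l m : ℕ} {f g h W W' V R : ℝ → ℝ → ℂ}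

theorem exists_schwartz_bound (c : 𝓢(ℝ, ℂ)) : ∃ C, 0 ≤ C ∧ ∀ y, ‖c y‖ ≤ C / (1 + y ^ 2) := by
  obtain ⟨C₀, h₀⟩ := c.decay' 0 0
  obtain ⟨C₂, h₂⟩ := c.decay' 2 0
  have h : ∀ y, ‖c y‖ ≤ (C₀ + C₂) / (1 + y ^ 2) := fun y => by
    rw [le_div_iff₀ (by positivity)]
    have h1 := h₀ y
    have h2 := h₂ y
    simp only [norm_iteratedFDeriv_zero, pow_zero, one_mul, Real.norm_eq_abs, sq_abs] at h1 h2
    linarith!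
  refine ⟨C₀ + C₂, ?_, h⟩
  have := (norm_nonneg _).trans (h 0)
  simpa using this

theorem exists_log_pow_le (j : ℕ) :
    ∃ C : ℝ, 0 ≤ C ∧ ∀ s : ℝ, 1 ≤ s → Real.log s ^ j ≤ C * s ^ (1 / 2 : ℝ) := by
  -- With ε = 1/(2(j + 1)) the bound ln s ≤ s^ε/ε, raised to the power j, costs s^{jε} ≤ s^{1/2}.
  have hε : (0 : ℝ) < 1 / (2 * (j + 1)) := by positivity
  refine ⟨((1 / (2 * (j + 1)) : ℝ)⁻¹) ^ j, by positivity, fun s hs => ?_⟩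
  have h1 := Real.log_le_rpow_div (by linarith : 0 ≤ s) hε
  calc Real.log s ^ j ≤ (s ^ (1 / (2 * (j + 1)) : ℝ) / (1 / (2 * (j + 1)))) ^ j :=
        pow_le_pow_left₀ (Real.log_nonneg hs) h1 j
    _ = ((1 / (2 * (j + 1)) : ℝ)⁻¹) ^ j * s ^ (1 / (2 * (j + 1)) * j : ℝ) := by
        rw [div_eq_mul_inv, mul_pow, mul_comm, Real.rpow_mul_natCast (by linarith)]
    _ ≤ _ := by
        gcongr ?_ * ?_
        refine Real.rpow_le_rpow_of_exponent_le hs ?_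
        · rw [div_mul_eq_mul_div, one_mul, div_le_div_iff₀ (by positivity) (by norm_num)]
          linarith

/-- Elements of `𝒮_k` are `O(s^{1/2 - k} / (1 + y²))`. -/
theorem Sym.exists_bound (hW : Sym β a b k W) : ∃ C : ℝ, 0 ≤ C ∧ ∀ s : ℝ, 1 ≤ s → ∀ y,
    ‖W s y‖ ≤ C * s ^ (1 / 2 - k : ℝ) / (1 + y ^ 2) := by
  induction hW with
  | zero h0 =>
    refine ⟨0, le_rfl, fun s hs y => ?_⟩
    rw [h0 s (by linarith)]; simp
  | cons _ c k' j hk h1 ih =>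
    obtain ⟨C, hC, h2⟩ := ih
    obtain ⟨C₁, hC₁, h3⟩ := exists_schwartz_bound c
    obtain ⟨C₂, hC₂, h4⟩ := exists_log_pow_le j
    refine ⟨C + C₁ * C₂, by positivity, fun s hs y => ?_⟩
    have hs0 : 0 < s := by linarith
    rw [h1 s hs0]
    refine (norm_add_le _ _).trans ?_
    rw [add_mul, add_div]
    refine add_le_add (h2 s hs y) ?_
    rw [NLS.term, norm_mul, norm_div, norm_mul, norm_osc, one_mul, norm_pow, norm_pow,
      Complex.norm_real, Complex.norm_real, Real.norm_of_nonneg (Real.log_nonneg hs),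
      Real.norm_of_nonneg hs0.le]
    have h5 : Real.log s ^ j / s ^ k' ≤ C₂ * s ^ (1 / 2 - k : ℝ) := by
      rw [Real.rpow_sub hs0, Real.rpow_natCast, ← mul_div_assoc]
      exact div_le_div₀ (by positivity) (h4 s hs) (by positivity) (pow_le_pow_right₀ hs hk)
    calc _ ≤ C₁ / (1 + y ^ 2) * (C₂ * s ^ (1 / 2 - k : ℝ)) :=
          mul_le_mul (h3 y) h5 (div_nonneg (pow_nonneg (Real.log_nonneg hs) _) (by positivity))
            (by positivity)
      _ = _ := by ring

/-- At fixed t a term is the Schwartz function c(x/t) times the chirp and oscillations, all of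
temperate growth. -/
theorem Sym.exists_schwartz (hW : Sym β a b k W) {t : ℝ} (ht : 0 < t) :
    ∃ F : 𝓢(ℝ, ℂ), ∀ x, F x = ofProfile W t x := by
  induction hW with
  | zero h0 => exact ⟨0, fun x => by simp [ofProfile_eq, h0 t ht]⟩
  | @cons W W' _ c k' j hk h1 ih =>
    obtain ⟨F, hF⟩ := ih
    let e : ℝ ≃L[ℝ] ℝ := ContinuousLinearEquiv.unitsEquivAut ℝ (Units.mk0 t⁻¹ (inv_ne_zero ht.ne'))
    have he : ∀ x, e x = x / t := fun x => by
      simp [e, div_eq_mul_inv]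
    have ht1 : (fun x : ℝ => x ^ 2 / (4 * t)).HasTemperateGrowth := by
      simp only [div_eq_mul_inv]; fun_prop
    have ha : (fun x : ℝ => a (e x)).HasTemperateGrowth :=
      a.hasTemperateGrowth.comp e.hasTemperateGrowth
    have hb : (fun x : ℝ => b (e x)).HasTemperateGrowth :=
      b.hasTemperateGrowth.comp e.hasTemperateGrowth
    have hc1 := hasTemperateGrowth_cexp ht1
    have hc2 := hasTemperateGrowth_cexp
      (p := fun x => -β * a (e x) ^ 2 * Real.log t + b (e x)) (by fun_prop)
    have hg : (fun x : ℝ => ((t ^ (-(1 / 2) : ℝ) : ℝ) : ℂ)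
        * Complex.exp (Complex.I * ((x ^ 2 / (4 * t) : ℝ) : ℂ))
        * (Complex.exp (Complex.I * ((-β * a (e x) ^ 2 * Real.log t + b (e x) : ℝ) : ℂ))
          * ((Real.log t : ℂ) ^ j * ((t : ℂ) ^ k')⁻¹))).HasTemperateGrowth := by fun_prop
    obtain ⟨d, hd⟩ := exists_schwartz_mul hg
      (SchwartzMap.compCLMOfContinuousLinearEquiv ℂ e c)
    refine ⟨F + d, fun x => ?_⟩
    rw [add_apply, hF, hd, ofProfile_eq, ofProfile_eq, h1 t ht, mul_add, NLS.term, osc, phase,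
      chirp]
    simp only [he, SchwartzMap.compCLMOfContinuousLinearEquiv_apply, Function.comp_apply]
    ring

open Classical in
/-- The Schwartz function `ofProfile W t`. -/
def prof (W : ℝ → ℝ → ℂ) (t : ℝ) : 𝓢(ℝ, ℂ) :=
  if h : ∃ F : 𝓢(ℝ, ℂ), ∀ x, F x = ofProfile W t x then h.choose else 0

theorem Sym.prof_apply (hW : Sym β a b k W) {t : ℝ} (ht : 0 < t) (x : ℝ) :
    prof W t x = ofProfile W t x := by
  rw [prof, dif_pos (hW.exists_schwartz ht)]
  exact (hW.exists_schwartz ht).choose_spec x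

theorem Sym.coe_prof (hW : Sym β a b k W) {t : ℝ} (ht : 0 < t) :
    ⇑(prof W t) = ofProfile W t := funext (hW.prof_apply ht)

theorem Sym.dS_prof (hW : Sym β a b k W) {t : ℝ} (ht : 0 < t) :
    dS (prof W t) = prof (NLS.Dx W) t := by
  ext x
  rw [SchwartzMap.derivCLM_apply, hW.coe_prof ht, hW.Dx.prof_apply ht]
  exact (hW.hasDerivAt_ofProfile_x ht x).deriv

theorem Sym.iterate_Dx (hW : Sym β a b k W) (j : ℕ) : Sym β a b k (NLS.Dx^[j] W) := by
  induction j with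
  | zero => exact hW
  | succ j ih => rw [Function.iterate_succ_apply']; exact ih.Dx

theorem Sym.dS_pow_prof (hW : Sym β a b k W) {t : ℝ} (ht : 0 < t) (j : ℕ) :
    (dS ^ j) (prof W t) = prof (NLS.Dx^[j] W) t := by
  induction j with
  | zero => rfl
  | succ j ih =>
    rw [pow_succ', mul_apply_eq_comp, ih, (hW.iterate_Dx j).dS_prof ht,
      Function.iterate_succ_apply']

theorem Sym.exists_bound_ofProfile (hW : Sym β a b k W) : ∃ C : ℝ, 0 ≤ C ∧ ∀ t : ℝ, 1 ≤ t → ∀ x,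
    ‖ofProfile W t x‖ ≤ C * t ^ (-k : ℝ) / (1 + (x / t) ^ 2) := by
  obtain ⟨C, hC, h⟩ := hW.exists_bound
  refine ⟨C, hC, fun t ht x => ?_⟩
  have ht0 : 0 < t := by linarith
  rw [ofProfile_eq, norm_mul, norm_chirp ht0]
  calc _ ≤ t ^ (-(1 / 2) : ℝ) * (C * t ^ (1 / 2 - k : ℝ) / (1 + (x / t) ^ 2)) := by
        gcongr; exact h t ht _
    _ = C * (t ^ (-(1 / 2) : ℝ) * t ^ (1 / 2 - k : ℝ)) / (1 + (x / t) ^ 2) := by ring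
    _ = _ := by rw [← Real.rpow_add ht0]; congr 3; ring

/-- Rescaling x = By: the squared weight has integral proportional to B, with one A for all widths.
With B = t this is the source of the factor t^{1/2} in later L² bounds. -/
theorem exists_n2_le : ∃ A : ℝ, 0 ≤ A ∧ ∀ (F : 𝓢(ℝ, ℂ)) (c B : ℝ), 0 ≤ c → 0 < B →
    (∀ x, ‖F x‖ ≤ c / (1 + (x / B) ^ 2)) → n2 F ≤ A * B ^ (1 / 2 : ℝ) * c := by
  have hi : Integrable fun y : ℝ => (1 + y ^ 2)⁻¹ ^ 2 := by
    refine integrable_inv_one_add_sq.mono' (by fun_prop) (.of_forall fun y => ?_)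
    have h1 : (1 + y ^ 2)⁻¹ ≤ 1 := inv_le_one_of_one_le₀ (by nlinarith [sq_nonneg y])
    have h0 : 0 ≤ (1 + y ^ 2)⁻¹ := by positivity
    rw [Real.norm_of_nonneg (by positivity)]
    nlinarith
  refine ⟨(∫ y : ℝ, (1 + y ^ 2)⁻¹ ^ 2) ^ (1 / 2 : ℝ), by positivity,
    fun F c B hc hB hF => ?_⟩
  set A := ∫ y : ℝ, (1 + y ^ 2)⁻¹ ^ 2
  have hA : 0 ≤ A := integral_nonneg fun y => by positivity
  have h1 : n2 F ^ 2 ≤ c ^ 2 * (B * A) := by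
    rw [n2_sq]
    have e : c ^ 2 * (B * A) = ∫ x, c ^ 2 * (1 + (x / B) ^ 2)⁻¹ ^ 2 := by
      rw [integral_const_mul, Measure.integral_comp_div (fun y : ℝ => (1 + y ^ 2)⁻¹ ^ 2) B,
        abs_of_pos hB, smul_eq_mul]
    rw [e]
    refine integral_mono (integrable_norm_sq F) ((hi.comp_div hB.ne').const_mul _) fun x => ?_
    simp only
    rw [← mul_pow]
    exact pow_le_pow_left₀ (norm_nonneg _) (by simpa [div_eq_mul_inv] using hF x) 2
  refine abs_le_of_sq_le_sq' (h1.trans (le_of_eq ?_)) (by positivity) |>.2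
  have hA2 : (A ^ (1 / 2 : ℝ)) ^ 2 = A := by
    rw [← Real.rpow_mul_natCast hA]; norm_num
  have hB2 : (B ^ (1 / 2 : ℝ)) ^ 2 = B := by
    rw [← Real.rpow_mul_natCast hB.le]; norm_num
  rw [mul_pow, mul_pow, hA2, hB2]; ring

theorem Sym.exists_n2_prof_le (hW : Sym β a b k W) : ∃ C : ℝ, 0 ≤ C ∧ ∀ t : ℝ, 1 ≤ t →
    n2 (prof W t) ≤ C * t ^ (1 / 2 - k : ℝ) := by
  obtain ⟨C, hC, h⟩ := hW.exists_bound_ofProfile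
  obtain ⟨A, hA, hn⟩ := exists_n2_le
  refine ⟨A * C, by positivity, fun t ht => ?_⟩
  have ht0 : 0 < t := by linarith
  refine (hn (prof W t) (C * t ^ (-k : ℝ)) t (by positivity) ht0 fun x => ?_).trans (le_of_eq ?_)
  · rw [hW.prof_apply ht0]; exact h t ht x
  · rw [sub_eq_add_neg, Real.rpow_add ht0]; ring

theorem Sym.exists_toH3_prof_le (hW : Sym β a b k W) : ∃ C : ℝ, 0 ≤ C ∧ ∀ t : ℝ, 1 ≤ t →
    ‖toH3 (prof W t)‖ ≤ C * t ^ (1 / 2 - k : ℝ) := by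
  choose C hC h using fun j => (hW.iterate_Dx j).exists_n2_prof_le
  refine ⟨∑ j ∈ Finset.range 4, C j, Finset.sum_nonneg fun j _ => hC j, fun t ht => ?_⟩
  have ht0 : 0 < t := by linarith
  refine norm_toH3_le (mul_nonneg (Finset.sum_nonneg fun j _ => hC j) (by positivity))
    fun j hj => ?_
  rw [hW.dS_pow_prof ht0]
  refine (h j t ht).trans ?_
  gcongr
  exact Finset.single_le_sum (f := C) (fun j _ => hC j) (Finset.mem_range.2 hj)

/-- The mean value inequality in t at each x, with the spatial weight of the widest profile, B,
dominating on the whole interval. -/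
theorem Sym.exists_n2_prof_sub_le (hW : Sym β a b k W) {B : ℝ} (hB : 1 ≤ B) :
    ∃ C : ℝ, 0 ≤ C ∧ ∀ t ∈ Icc 1 B, ∀ t' ∈ Icc 1 B,
      n2 (prof W t - prof W t') ≤ C * |t - t'| := by
  obtain ⟨C, hC, h⟩ := hW.Dt.exists_bound_ofProfile
  obtain ⟨A, hA, hn⟩ := exists_n2_le
  have hB0 : 0 < B := by linarith
  refine ⟨A * B ^ (1 / 2 : ℝ) * C, by positivity, fun t ht t' ht' => ?_⟩
  rw [mul_assoc (A * _)]
  refine hn _ (C * |t - t'|) B (by positivity) hB0 fun x => ?_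
  have ht0 : 0 < t := by linarith [ht.1]
  have ht0' : 0 < t' := by linarith [ht'.1]
  rw [sub_apply, hW.prof_apply ht0, hW.prof_apply ht0', mul_div_right_comm]
  refine (convex_Icc (1 : ℝ) B).norm_image_sub_le_of_norm_hasDerivWithin_le
    (f := fun τ => ofProfile W τ x)
    (fun τ hτ => (hW.hasDerivAt_ofProfile_t (by linarith [hτ.1]) x).hasDerivWithinAt)
    (fun τ hτ => ?_) ht' ht
  have hτ0 : 0 < τ := by linarith [hτ.1]
  refine (h τ hτ.1 x).trans ?_
  have h1 : τ ^ (-k : ℝ) ≤ 1 := Real.rpow_le_one_of_one_le_of_nonpos hτ.1 (by simp)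
  have h2 : (x / B) ^ 2 ≤ (x / τ) ^ 2 := by
    rw [_root_.div_pow, _root_.div_pow]
    have := hτ.2
    gcongr
  exact div_le_div₀ hC (mul_le_of_le_one_right hC h1) (by positivity) (by linarith)

theorem Sym.continuousOn_toH3_prof (hW : Sym β a b k W) :
    ContinuousOn (fun t => toH3 (prof W t)) (Ici 1) := by
  intro t₀ ht₀
  have ht₀' : 1 ≤ t₀ := ht₀
  choose C hC h using fun j => (hW.iterate_Dx j).exists_n2_prof_sub_le
    (show 1 ≤ t₀ + 1 by linarith)
  have hn : Icc 1 (t₀ + 1) ∈ nhdsWithin t₀ (Ici 1) := by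
    rw [← Ici_inter_Iic]
    exact Filter.inter_mem self_mem_nhdsWithin
      (mem_nhdsWithin_of_mem_nhds (Iic_mem_nhds (by linarith)))
  refine ContinuousWithinAt.mono_of_mem_nhdsWithin ?_ hn
  refine (LipschitzOnWith.of_dist_le_mul (K := Real.toNNReal (∑ j ∈ Finset.range 4, C j)) fun t ht t' ht' => ?_).continuousOn t₀
    ⟨ht₀', by linarith⟩
  have ht0 : 0 < t := by linarith [ht.1]
  have ht0' : 0 < t' := by linarith [ht'.1]
  rw [dist_eq_norm, ← map_sub, Real.coe_toNNReal _ (Finset.sum_nonneg fun j _ => hC j), Real.dist_eq]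
  refine norm_toH3_le (mul_nonneg (Finset.sum_nonneg fun j _ => hC j) (abs_nonneg _))
    fun j hj => ?_
  rw [map_sub, hW.dS_pow_prof ht0, hW.dS_pow_prof ht0']
  refine (h j t ht t' ht').trans ?_
  gcongr
  exact Finset.single_le_sum (f := C) (fun j _ => hC j) (Finset.mem_range.2 hj)

theorem Sym.iterate_Dx_sub (hR : Sym β a b 1 (fun s y => V s y - V0 β a b s y)) (j : ℕ) :
    Sym β a b 1 (fun s y => NLS.Dx^[j] V s y - (Complex.I / 2 * y) ^ j * V0 β a b s y) := by
  have hid := hasTemperateGrowth_coe_id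
  have hg : (fun y : ℝ => Complex.I / 2 * (y : ℂ)).HasTemperateGrowth := by fun_prop
  induction j with
  | zero => exact hR.congr fun s _ y => by simp
  | succ j ih =>
    refine ((hR.of_sub.iterate_Dx j).Dx_sub.add (ih.temperate_mul hg)).congr fun s _ y => ?_
    rw [Function.iterate_succ_apply']; ring

/-- The multiplier norm of an approximate solution is `O(t^{-1/2})`, with a constant that depends
only on the leading profile. -/
theorem exists_norm_mulH_prof_le (β : ℝ) (a b : 𝓢(ℝ, ℝ)) : ∃ K : ℝ, 0 ≤ K ∧ ∀ V : ℝ → ℝ → ℂ,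
    Sym β a b 1 (fun s y => V s y - V0 β a b s y) → ∃ T : ℝ, 1 ≤ T ∧ ∀ t, T ≤ t →
      ‖mulH (toH3 (prof V t))‖ ≤ K * t ^ (-(1 / 2) : ℝ) := by
  have hid := hasTemperateGrowth_coe_id
  obtain ⟨d, hd⟩ := exists_schwartz_coe a
  have hex : ∀ j : ℕ, ∃ C : ℝ, 0 ≤ C ∧ ∀ y : ℝ, ‖(Complex.I / 2 * y) ^ j * (a y : ℂ)‖ ≤ C := by
    intro j
    have hg : (fun y : ℝ => (Complex.I / 2 * (y : ℂ)) ^ j).HasTemperateGrowth := by fun_prop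
    obtain ⟨e, he⟩ := exists_schwartz_mul hg d
    obtain ⟨C, hC, h⟩ := exists_schwartz_bound e
    refine ⟨C, hC, fun y => ?_⟩
    rw [← hd, ← he]
    exact (h y).trans (div_le_self hC (by nlinarith [sq_nonneg y]))
  choose C hC h using hex
  set S := ∑ j ∈ Finset.range 4, C j
  have hS : 0 ≤ S := Finset.sum_nonneg fun j _ => hC j
  -- S bounds (iy/2)^j a(y) for j < 4, and the 1 absorbs the remainder in 𝒮_1 once t ≥ S'². K is
  -- fixed before V is given; only the starting time depends on V.
  refine ⟨8 * (S + 1), by positivity, fun V hR => ?_⟩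
  choose D hD hb using fun j => (hR.iterate_Dx_sub j).exists_bound
  set S' := ∑ j ∈ Finset.range 4, D j
  have hS' : 0 ≤ S' := Finset.sum_nonneg fun j _ => hD j
  refine ⟨max 1 (S' ^ 2), le_max_left _ _, fun t ht => ?_⟩
  have ht1 : 1 ≤ t := (le_max_left _ _).trans ht
  have ht0 : 0 < t := by linarith
  have hsmall : S' * t ^ (1 / 2 - (1 : ℕ) : ℝ) ≤ 1 := by
    rw [show (1 / 2 - (1 : ℕ) : ℝ) = -(1 / 2) by norm_num, Real.rpow_neg ht0.le,
      ← div_eq_mul_inv, div_le_one (by positivity), ← Real.sqrt_eq_rpow]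
    exact Real.le_sqrt_of_sq_le ((le_max_right _ _).trans ht)
  rw [mulH_toH3_left, mul_assoc]
  refine norm_mulL_le_of_bound fun j hj x => ?_
  have hj' := Finset.mem_range.2 hj
  rw [hR.of_sub.dS_pow_prof ht0, (hR.of_sub.iterate_Dx j).prof_apply ht0, ofProfile_eq, norm_mul,
    norm_chirp ht0, mul_comm]
  gcongr
  have h1 := hb j t ht1 (x / t)
  have h2 : ‖(Complex.I / 2 * ((x / t : ℝ) : ℂ)) ^ j * V0 β a b t (x / t)‖ ≤ C j := by
    rw [V0, ← mul_assoc, norm_mul, norm_osc, mul_one]; exact h j _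
  calc _ = ‖(Complex.I / 2 * ((x / t : ℝ) : ℂ)) ^ j * V0 β a b t (x / t)
        + (NLS.Dx^[j] V t (x / t) - (Complex.I / 2 * ((x / t : ℝ) : ℂ)) ^ j
          * V0 β a b t (x / t))‖ := by congr 1; ring
    _ ≤ C j + D j * t ^ (1 / 2 - (1 : ℕ) : ℝ) / (1 + (x / t) ^ 2) :=
        (norm_add_le _ _).trans (add_le_add h2 h1)
    _ ≤ S + S' * t ^ (1 / 2 - (1 : ℕ) : ℝ) := by
        refine add_le_add (Finset.single_le_sum (f := C) (fun j _ => hC j) hj') ?_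
        refine (div_le_self (mul_nonneg (hD j) (by positivity))
          (by nlinarith [sq_nonneg (x / t)])).trans ?_
        gcongr
        exact Finset.single_le_sum (f := D) (fun j _ => hD j) hj'
    _ ≤ S + 1 := by linarith

end

section

/-! ### The nonlinearity on `H³` -/

theorem norm_mulH_apply_le {u : H3} {A : ℝ} (hu : ‖mulH u‖ ≤ A) {w : H3} {B : ℝ} (hw : ‖w‖ ≤ B) :
    ‖mulH u w‖ ≤ A * B :=
  ((mulH u).le_opNorm w).trans (mul_le_mul hu hw (norm_nonneg _) ((norm_nonneg _).trans hu))

theorem norm_mulH_mulH_le {u v : H3} {A B : ℝ} (hu : ‖mulH u‖ ≤ A) (hv : ‖mulH v‖ ≤ B) :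
    ‖mulH (mulH u v)‖ ≤ A * B := by
  have hA := (norm_nonneg _).trans hu
  have hB := (norm_nonneg _).trans hv
  refine ContinuousLinearMap.opNorm_le_bound _ (by positivity) fun w => ?_
  rw [mulH_assoc, mul_assoc]
  exact norm_mulH_apply_le hu (norm_mulH_apply_le hv le_rfl)

/-- The cubic nonlinearity `|u|² u` on `H³`. -/
def cubic (u : H3) : H3 := mulH u (mulH (conjH u) u)

/-- The quintic nonlinearity `|u|⁴ u` on `H³`. -/
def quintic (u : H3) : H3 := mulH u (mulH (conjH u) (cubic u))

/-- The nonlinearity `β |u|² u + γ |u|⁴ u` on `H³`. -/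
def nonlin (β γ : ℝ) (u : H3) : H3 := (β : ℂ) • cubic u + (γ : ℂ) • quintic u

variable {β γ : ℝ} {u v : H3} {A : ℝ}

/-- Telescoping, with one factor measured in H³ and the others by multiplier norms. Taking w = u
gives the cubic bound A² + 2A² = 3A²; taking w cubic gives 3A⁴ + 2A⁴ = 5A⁴. -/
theorem norm_mulH_conjH_mul_sub_le {w w' : H3} {B C : ℝ} (hu : ‖mulH u‖ ≤ A) (hv : ‖mulH v‖ ≤ A)
    (hw : ‖w - w'‖ ≤ B) (hw' : ‖mulH w'‖ ≤ C) :
    ‖mulH u (mulH (conjH u) w) - mulH v (mulH (conjH v) w')‖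
      ≤ A * (A * B) + 2 * (A * (C * ‖u - v‖)) := by
  have hu' : ‖mulH (conjH u)‖ ≤ A := (norm_mulH_conjH_le u).trans hu
  have hv' : ‖mulH (conjH v)‖ ≤ A := (norm_mulH_conjH_le v).trans hv
  have hc : ‖conjH (u - v)‖ ≤ ‖u - v‖ := norm_conjH_le _
  have e : mulH u (mulH (conjH u) w) - mulH v (mulH (conjH v) w')
      = mulH u (mulH (conjH u) (w - w')) + (mulH u (mulH w' (conjH (u - v)))
        + mulH (conjH v) (mulH w' (u - v))) := by
    rw [← mulH_assoc (conjH v), mulH_comm _ (u - v), mulH_comm w' (conjH (u - v))]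
    simp only [map_sub, sub_apply]
    abel
  rw [e, two_mul]
  refine (norm_add_le _ _).trans (add_le_add ?_ ((norm_add_le _ _).trans (add_le_add ?_ ?_)))
  · exact norm_mulH_apply_le hu (norm_mulH_apply_le hu' hw)
  · exact norm_mulH_apply_le hu (norm_mulH_apply_le hw' hc)
  · exact norm_mulH_apply_le hv' (norm_mulH_apply_le hw' le_rfl)

theorem norm_mulH_cubic_le (hu : ‖mulH u‖ ≤ A) : ‖mulH (cubic u)‖ ≤ A * (A * A) :=
  norm_mulH_mulH_le hu (norm_mulH_mulH_le ((norm_mulH_conjH_le u).trans hu) hu)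

theorem norm_cubic_sub_le (hu : ‖mulH u‖ ≤ A) (hv : ‖mulH v‖ ≤ A) :
    ‖cubic u - cubic v‖ ≤ 3 * A ^ 2 * ‖u - v‖ :=
  (norm_mulH_conjH_mul_sub_le hu hv le_rfl hv).trans (le_of_eq (by ring))

theorem norm_quintic_sub_le (hu : ‖mulH u‖ ≤ A) (hv : ‖mulH v‖ ≤ A) :
    ‖quintic u - quintic v‖ ≤ 5 * A ^ 4 * ‖u - v‖ :=
  (norm_mulH_conjH_mul_sub_le hu hv (norm_cubic_sub_le hu hv) (norm_mulH_cubic_le hv)).trans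
    (le_of_eq (by ring))

theorem norm_nonlin_sub_le (hu : ‖mulH u‖ ≤ A) (hv : ‖mulH v‖ ≤ A) :
    ‖nonlin β γ u - nonlin β γ v‖ ≤ (3 * |β| * A ^ 2 + 5 * |γ| * A ^ 4) * ‖u - v‖ := by
  rw [nonlin, nonlin, add_sub_add_comm, ← smul_sub, ← smul_sub]
  refine (norm_add_le _ _).trans ?_
  rw [norm_smul, norm_smul, Complex.norm_real, Complex.norm_real, Real.norm_eq_abs,
    Real.norm_eq_abs]
  calc _ ≤ |β| * (3 * A ^ 2 * ‖u - v‖) + |γ| * (5 * A ^ 4 * ‖u - v‖) := by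
        gcongr
        · exact norm_cubic_sub_le hu hv
        · exact norm_quintic_sub_le hu hv
    _ = _ := by ring

theorem continuous_nonlin : Continuous (nonlin β γ) := by
  unfold nonlin quintic cubic
  fun_prop

theorem ev_nonlin (x : ℝ) (u : H3) :
    ev 0 x (nonlin β γ u) = β * G₁ (ev 0 x u) + γ * G₂ (ev 0 x u) := by
  simp only [nonlin, quintic, cubic, map_add, map_smul, ev_mulH, ev_conjH, smul_eq_mul, G₁_eq,
    G₂_eq]
  ring

/-! ### Solutions near an approximate solution -/

/-- The right-hand side of the equation for `z t = e^{-it∂²} (v - h)`, where `h` solves the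
nonlinear Schrödinger equation with error `E`. -/
def rhs (β γ : ℝ) (h E : ℝ → H3) (t : ℝ) (z : H3) : H3 :=
  -(Complex.I • schrH (-t) (nonlin β γ (h t + schrH t z) - nonlin β γ (h t) - E t))

/-- With multiplier norms of size t^{-1/2} the cubic term is Lipschitz with constant O(1/t), the
borderline rate that `exists_terminal_solution` admits; the quintic one is even smaller. -/
theorem exists_solution_near {h E : ℝ → H3} {T K m : ℝ} (hT : 1 ≤ T) (hK : 0 ≤ K)
    (hm : 2 * (3 * |β| * (K + 16) ^ 2 + 5 * |γ| * (K + 16) ^ 4) + 1 ≤ m)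
    (hh : ContinuousOn h (Ici T)) (hE : ContinuousOn E (Ici T))
    (hhb : ∀ t, T ≤ t → ‖mulH (h t)‖ ≤ K * t ^ (-(1 / 2) : ℝ))
    (hEb : ∀ t, T ≤ t → ‖E t‖ ≤ 1 / 2 * t ^ (-m - 1)) :
    ∃ (z : ℝ → H3) (C : ℝ), 0 ≤ C ∧ ∀ t, T < t → HasDerivAt z (rhs β γ h E t (z t)) t ∧
      ‖z t‖ ≤ t ^ (-m) ∧ ‖rhs β γ h E t (z t)‖ ≤ C * t ^ (-m) := by
  set L := 3 * |β| * (K + 16) ^ 2 + 5 * |γ| * (K + 16) ^ 4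
  have hL0 : 0 ≤ L := by positivity
  have hcont : ContinuousOn (Function.uncurry (rhs β γ h E)) (Ici T ×ˢ univ) := by
    have h1 : ContinuousOn (fun p : ℝ × H3 => h p.1) (Ici T ×ˢ univ) :=
      hh.comp continuousOn_fst fun p hp => hp.1
    have h2 : ContinuousOn (fun p : ℝ × H3 => E p.1) (Ici T ×ˢ univ) :=
      hE.comp continuousOn_fst fun p hp => hp.1
    have h3 := ((continuous_nonlin (β := β) (γ := γ)).comp_continuousOn
      (h1.add continuous_schrH.continuousOn)).sub
      ((continuous_nonlin (β := β) (γ := γ)).comp_continuousOn h1) |>.sub h2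
    exact ((continuous_schrH.comp_continuousOn
      ((continuous_fst.neg.continuousOn).prodMk h3)).const_smul Complex.I).neg
  have hLip : ∀ t, T ≤ t → ∀ z z' : H3, ‖z‖ ≤ t ^ (-m) → ‖z'‖ ≤ t ^ (-m) →
      ‖rhs β γ h E t z - rhs β γ h E t z'‖ ≤ L / t * ‖z - z'‖ := by
    intro t ht z z' hz hz'
    have ht1 : 1 ≤ t := hT.trans ht
    have ht0 : 0 < t := by linarith
    have hmt : t ^ (-m) ≤ t ^ (-(1 / 2) : ℝ) :=
      Real.rpow_le_rpow_of_exponent_le ht1 (by linarith)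
    -- The 16 is the algebra constant applied to the correction, whose norm is at most t^{-m} ≤
    -- t^{-1/2}.
    have hb : ∀ z : H3, ‖z‖ ≤ t ^ (-m) →
        ‖mulH (h t + schrH t z)‖ ≤ (K + 16) * t ^ (-(1 / 2) : ℝ) := fun z hz => by
      rw [map_add, add_mul]
      refine (norm_add_le _ _).trans (add_le_add (hhb t ht) ((norm_mulH_le _).trans ?_))
      rw [norm_schrH]
      gcongr
      exact hz.trans hmt
    have hsq : (t ^ (-(1 / 2) : ℝ)) ^ 2 = t⁻¹ := by
      rw [← Real.rpow_mul_natCast ht0.le]; norm_num [Real.rpow_neg_one]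
    have key := norm_nonlin_sub_le (β := β) (γ := γ) (hb z hz) (hb z' hz')
    rw [add_sub_add_left_eq_sub, ← map_sub, norm_schrH] at key
    rw [rhs, rhs, neg_sub_neg, ← smul_sub, ← map_sub, norm_smul, Complex.norm_I, one_mul,
      norm_schrH, sub_sub_sub_cancel_right, sub_sub_sub_cancel_right, norm_sub_rev]
    refine key.trans ?_
    gcongr
    rw [mul_pow, mul_pow, show (t ^ (-(1 / 2) : ℝ)) ^ 4 = ((t ^ (-(1 / 2) : ℝ)) ^ 2) ^ 2 by ring,
      hsq]
    have hinv : t⁻¹ ^ 2 ≤ t⁻¹ := by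
      have := inv_le_one_of_one_le₀ ht1
      have := inv_pos.2 ht0
      nlinarith
    calc _ ≤ 3 * |β| * ((K + 16) ^ 2 * t⁻¹) + 5 * |γ| * ((K + 16) ^ 4 * t⁻¹) := by gcongr
      _ = L / t := by simp only [L]; ring
  have hzero : ∀ t, T ≤ t → ‖rhs β γ h E t 0‖ ≤ 1 / 2 * t ^ (-m - 1) := by
    intro t ht
    rw [rhs, map_zero, add_zero, sub_self, zero_sub, norm_neg, norm_smul, Complex.norm_I, one_mul,
      norm_schrH, norm_neg]
    exact hEb t ht
  obtain ⟨z, hz⟩ := exists_terminal_solution (by linarith) hL0 hm hcont hLip hzero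
  refine ⟨z, L + 1 / 2, by positivity, fun t ht => ⟨(hz t ht).1, (hz t ht).2, ?_⟩⟩
  have ht1 : 1 ≤ t := hT.trans ht.le
  have ht0 : 0 < t := by linarith
  have h1 := hLip t ht.le (z t) 0 (hz t ht).2 (by simpa using Real.rpow_nonneg ht0.le _)
  rw [sub_zero] at h1
  calc _ = ‖(rhs β γ h E t (z t) - rhs β γ h E t 0) + rhs β γ h E t 0‖ := by rw [sub_add_cancel]
    _ ≤ L / t * t ^ (-m) + 1 / 2 * t ^ (-m - 1) := by
        refine (norm_add_le _ _).trans (add_le_add (h1.trans ?_) (hzero t ht.le))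
        gcongr
        exact (hz t ht).2
    _ ≤ L * t ^ (-m) + 1 / 2 * t ^ (-m) := by
        gcongr
        · exact div_le_self hL0 ht1
        · linarith
    _ = _ := by ring

variable {a b : 𝓢(ℝ, ℝ)} {k : ℕ} {V W : ℝ → ℝ → ℂ}

theorem Sym.eLpNorm_ofProfile_le (hW : Sym β a b k W) : ∃ C : ℝ, 0 ≤ C ∧ ∀ t : ℝ, 1 ≤ t →
    eLpNorm (ofProfile W t) 2 volume ≤ ENNReal.ofReal (C * t ^ (1 / 2 - k : ℝ)) := by
  obtain ⟨C, hC, h⟩ := hW.exists_n2_prof_le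
  refine ⟨C, hC, fun t ht => ?_⟩
  rw [← hW.coe_prof (by linarith), eLpNorm_eq_n2]
  exact ENNReal.ofReal_le_ofReal (h t ht)

theorem Sym.ev_zero_prof (hW : Sym β a b k W) {t : ℝ} (ht : 0 < t) (x : ℝ) :
    ev 0 x (toH3 (prof W t)) = ofProfile W t x := by
  rw [ev_toH3 (by norm_num), pow_zero]; exact hW.prof_apply ht x

theorem Sym.ev_two_prof (hW : Sym β a b k W) {t : ℝ} (ht : 0 < t) (x : ℝ) :
    ev 2 x (toH3 (prof W t)) = ofProfile (NLS.Dx (NLS.Dx W)) t x := by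
  rw [ev_toH3 (by norm_num), hW.dS_pow_prof ht]; exact hW.Dx.Dx.prof_apply ht x

/-- The time derivative of `h + e^{it∂²} z`, where `h` is an approximate solution. -/
theorem Sym.hasDerivAt_ev_add (hV : Sym β a b 0 V) {z : ℝ → H3} {z' : H3} {t : ℝ} (ht : 0 < t)
    (hz : HasDerivAt z z' t) (x : ℝ) :
    HasDerivAt (fun τ => ev 0 x (toH3 (prof V τ) + schrH τ (z τ)))
      (ofProfile (NLS.Dt V) t x + (Complex.I * ev 2 x (schrH t (z t)) + ev 0 x (schrH t z'))) t := by
  refine ((hV.hasDerivAt_ofProfile_t ht x).add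
    (hasDerivAt_ev_schrH_curve hz x)).congr_of_eventuallyEq ?_
  filter_upwards [eventually_gt_nhds ht] with τ hτ
  rw [map_add, hV.ev_zero_prof hτ]; rfl

theorem schrH_rhs (h E : ℝ → H3) (t : ℝ) (z : H3) : schrH t (rhs β γ h E t z)
    = -(Complex.I • (nonlin β γ (h t + schrH t z) - nonlin β γ (h t) - E t)) := by
  rw [rhs, map_neg, map_smul, schrH_schrH, add_neg_cancel, schrH_zero]

theorem iteratedDeriv_two_ev (u : H3) (x : ℝ) :
    iteratedDeriv 2 (fun x => ev 0 x u) x = ev 2 x u := by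
  rw [iteratedDeriv_succ, iteratedDeriv_one,
    show deriv (fun x => ev 0 x u) = fun x => ev 1 x u from
      funext fun x => (hasDerivAt_ev (by norm_num) u x).deriv]
  exact (hasDerivAt_ev (by norm_num) u x).deriv

section

attribute [local irreducible] ev schrH mulH conjH H3 toH3 prof

/-- Point evaluations of orders 0, 1, 2 are jointly continuous in (x, u), so continuity in H³ gives
all spatial regularity; ∂_t is then continuous by the equation. -/
theorem isClassicalSolution_ev {u : ℝ → H3} {T : ℝ} (huc : ContinuousOn u (Ioi T))
    (hdt : ∀ t, T < t → ∀ x, HasDerivAt (fun τ => ev 0 x (u τ))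
      (Complex.I * (ev 2 x (u t) - ev 0 x (nonlin β γ (u t)))) t) :
    IsClassicalSolution β γ T fun t x => ev 0 x (u t) := by
  have hev : ∀ j < 3, ContinuousOn (fun p : ℝ × ℝ => ev j p.2 (u p.1)) (Ioi T ×ˢ univ) :=
    fun j hj => (continuous_ev hj).comp_continuousOn
      (continuousOn_snd.prodMk (huc.comp continuousOn_fst fun p hp => hp.1))
  have hnl : ContinuousOn (fun p : ℝ × ℝ => ev 0 p.2 (nonlin β γ (u p.1))) (Ioi T ×ˢ univ) :=
    (continuous_ev (by norm_num)).comp_continuousOn (continuousOn_snd.prodMk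
      (continuous_nonlin.comp_continuousOn (huc.comp continuousOn_fst fun p hp => hp.1)))
  refine ⟨fun t ht x => (hdt t ht x).differentiableAt, fun t _ => contDiff_ev _,
    hev 0 (by norm_num), ?_, ?_, ?_, fun t ht x => ?_⟩
  · exact ((continuousOn_const (c := Complex.I)).mul ((hev 2 (by norm_num)).sub hnl)).congr
      fun p hp => (hdt p.1 hp.1 p.2).deriv
  · exact (hev 1 (by norm_num)).congr fun p _ => (hasDerivAt_ev (by norm_num) _ _).deriv
  · exact (hev 2 (by norm_num)).congr fun p _ => iteratedDeriv_two_ev _ _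
  · rw [(hdt t ht x).deriv, iteratedDeriv_two_ev, ev_nonlin]
    linear_combination (ev 2 x (u t) - (β * G₁ (ev 0 x (u t)) + γ * G₂ (ev 0 x (u t))))
      * Complex.I_sq

/-- The approximate profile leaves the error E, and the equation for the correction was forced with
-E; in the sum they cancel. -/
theorem Sym.isClassicalSolution (hV : Sym β a b 0 V) (hP : Sym β a b 0 (Psi β γ V)) {T : ℝ}
    (hT : 1 ≤ T) {z : ℝ → H3} (hz : ∀ t, T < t → HasDerivAt z
      (rhs β γ (fun t => toH3 (prof V t)) (fun t => toH3 (prof (Psi β γ V) t)) t (z t)) t) :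
    IsClassicalSolution β γ T fun t x => ev 0 x (toH3 (prof V t) + schrH t (z t)) := by
  have hzc : ContinuousOn z (Ioi T) := fun t ht => (hz t ht).continuousAt.continuousWithinAt
  have hsz : ContinuousOn (fun t => schrH t (z t)) (Ioi T) :=
    continuous_schrH.comp_continuousOn (f := fun t => (t, z t)) (continuousOn_id.prodMk hzc)
  have hVc : ContinuousOn (fun t => toH3 (prof V t)) (Ioi T) :=
    hV.continuousOn_toH3_prof.mono fun t ht => hT.trans (le_of_lt ht)
  refine isClassicalSolution_ev (hVc.add hsz) fun t ht x => ?_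
  · have ht0 : 0 < t := by linarith
    have h1 := hV.ofProfile_psi (γ := γ) ht0 x
    have e0 := hV.ev_zero_prof ht0 x
    have e2 := hV.ev_two_prof ht0 x
    have eP := hP.ev_zero_prof ht0 x
    refine (hV.hasDerivAt_ev_add ht0 (hz t ht) x).congr_deriv ?_
    rw [schrH_rhs]
    simp only [map_neg, map_smul, map_sub, map_add, smul_eq_mul, ev_nonlin, e0, e2, eP]
    linear_combination (-Complex.I) * h1 + ofProfile (NLS.Dt V) t x * Complex.I_sq

end

/-- The contraction needs a decay rate possibly larger than N, so V is first refined to U of order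
M. There is no circularity, because K, and with it the required M, does not depend on U. -/
theorem exists_solution_near_approx {N : ℕ}
    (hR : Sym β a b 1 (fun s y => V s y - V0 β a b s y)) (hP : Sym β a b (N + 2) (Psi β γ V)) :
    ∃ (T C : ℝ) (v : ℝ → ℝ → ℂ), 1 ≤ T ∧ 0 ≤ C ∧ IsClassicalSolution β γ T v ∧
      ∀ t : ℝ, T < t → spaceTimeH1 (fun τ x => v τ x - ofProfile V τ x) t
        ≤ ENNReal.ofReal (C / t ^ N) := by
  obtain ⟨K, hK, hKb⟩ := exists_norm_mulH_prof_le β a b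
  set L := 2 * (3 * |β| * (K + 16) ^ 2 + 5 * |γ| * (K + 16) ^ 4) + 1
  set M := max N ⌈L⌉₊
  have hML : L ≤ (M : ℝ) := (Nat.le_ceil L).trans (by exact_mod_cast le_max_right _ _)
  have hMN : N ≤ M := le_max_left _ _
  obtain ⟨U, hU, hUV, hPU⟩ := hR.exists_psi_of_le hMN hP
  have hU0 := hU.of_sub
  obtain ⟨T₁, hT₁, hb₁⟩ := hKb U hU
  obtain ⟨C₂, hC₂, hb₂⟩ := hPU.exists_toH3_prof_le
  set T := max T₁ ((2 * C₂) ^ 2)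
  have hT : 1 ≤ T := hT₁.trans (le_max_left _ _)
  -- Order M + 2 in H³ gives C₂t^{-M-3/2}; the spare t^{-1/2} pays for 2C₂ once t ≥ (2C₂)².
  have hEb : ∀ t, T ≤ t → ‖toH3 (prof (Psi β γ U) t)‖ ≤ 1 / 2 * t ^ (-(M : ℝ) - 1) := by
    intro t ht
    have ht1 : 1 ≤ t := hT.trans ht
    have ht0 : 0 < t := by linarith
    refine (hb₂ t ht1).trans ?_
    have h1 : 2 * C₂ ≤ t ^ (1 / 2 : ℝ) := by
      rw [← Real.sqrt_eq_rpow]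
      exact Real.le_sqrt_of_sq_le ((le_max_right _ _).trans ht)
    have h2 : t ^ (1 / 2 - ((M + 2 : ℕ) : ℝ)) * t ^ (1 / 2 : ℝ) = t ^ (-(M : ℝ) - 1) := by
      rw [← Real.rpow_add ht0]; congr 1; push_cast; ring
    rw [← h2]
    have h3 := Real.rpow_nonneg ht0.le (1 / 2 - ((M + 2 : ℕ) : ℝ))
    nlinarith
  have hmono : Ici T ⊆ Ici (1 : ℝ) := Ici_subset_Ici.2 hT
  obtain ⟨z, C₃, hC₃, hz⟩ := exists_solution_near (β := β) (γ := γ)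
    (h := fun t => toH3 (prof U t)) (E := fun t => toH3 (prof (Psi β γ U) t)) hT hK hML
    (hU0.continuousOn_toH3_prof.mono hmono) (hPU.continuousOn_toH3_prof.mono hmono)
    (fun t ht => hb₁ t ((le_max_left _ _).trans ht)) hEb
  obtain ⟨D₀, hD₀, hd₀⟩ := hUV.eLpNorm_ofProfile_le
  obtain ⟨D₁, hD₁, hd₁⟩ := hUV.Dx.eLpNorm_ofProfile_le
  obtain ⟨D₂, hD₂, hd₂⟩ := hUV.Dt.eLpNorm_ofProfile_le
  refine ⟨T, (D₀ + 1) + (D₁ + 1) + (D₂ + (1 + C₃)), _, hT, by positivity,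
    hU0.isClassicalSolution (hPU.mono (Nat.zero_le _)) hT fun t ht => (hz t ht).1,
    fun t ht => ?_⟩
  have ht1 : 1 ≤ t := hT.trans ht.le
  have ht0 : 0 < t := by linarith
  obtain ⟨hz1, hz2, hz3⟩ := hz t ht
  have hpN : t ^ (-(N : ℝ)) = 1 / t ^ N := by
    rw [Real.rpow_neg ht0.le, Real.rpow_natCast, one_div]
  -- U - V lies in 𝒮_{N+1}; the exponent 1/2 - (N + 1) is below -N, with half a power to spare.
  have hp1 : t ^ (1 / 2 - ((N + 1 : ℕ) : ℝ)) ≤ 1 / t ^ N := by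
    rw [← hpN]
    exact Real.rpow_le_rpow_of_exponent_le ht1 (by push_cast; linarith)
  have hp2 : t ^ (-(M : ℝ)) ≤ 1 / t ^ N := by
    rw [← hpN]
    exact Real.rpow_le_rpow_of_exponent_le ht1 (neg_le_neg (by exact_mod_cast hMN))
  have hpp : 0 < 1 / t ^ N := by positivity
  have hw : ∀ τ, 0 < τ → ∀ x, ev 0 x (toH3 (prof U τ) + schrH τ (z τ)) - ofProfile V τ x
      = ofProfile (fun s y => U s y - V s y) τ x + ev 0 x (schrH τ (z τ)) := by
    intro τ hτ x
    rw [map_add, hU0.ev_zero_prof hτ]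
    simp only [ofProfile]; ring
  have hmeas : ∀ {k : ℕ} {W : ℝ → ℝ → ℂ}, Sym β a b k W →
      AEStronglyMeasurable (ofProfile W t) volume := fun hW => by
    rw [← hW.coe_prof ht0]; exact (prof _ t).continuous.aestronglyMeasurable
  have hmev : ∀ j < 3, ∀ u : H3, AEStronglyMeasurable (fun x => ev j x u) volume :=
    fun j hj u => (continuous_ev_apply hj u).aestronglyMeasurable
  have hsum : ∀ {A B : ℝ}, 0 ≤ A → 0 ≤ B → ENNReal.ofReal (A / t ^ N) + ENNReal.ofReal (B / t ^ N)
      = ENNReal.ofReal ((A + B) / t ^ N) := fun {A B} hA hB => by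
    rw [← ENNReal.ofReal_add (by positivity) (by positivity), add_div]
  have hofP : ∀ {D : ℝ}, 0 ≤ D → ENNReal.ofReal (D * t ^ (1 / 2 - ((N + 1 : ℕ) : ℝ)))
      ≤ ENNReal.ofReal (D / t ^ N) := fun {D} hD => ENNReal.ofReal_le_ofReal (by
    rw [← mul_one_div D]; gcongr)
  have hofE : ∀ {D : ℝ} {w : H3}, 0 ≤ D → ‖w‖ ≤ D * t ^ (-(M : ℝ)) → ∀ j < 3,
      eLpNorm (fun x => ev j x w) 2 volume ≤ ENNReal.ofReal (D / t ^ N) :=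
    fun {D w} hD hw j hj => (eLpNorm_ev_le hj w).trans (ENNReal.ofReal_le_ofReal (hw.trans (by
      rw [← mul_one_div D]; gcongr)))
  have hsz : ‖schrH t (z t)‖ ≤ 1 * t ^ (-(M : ℝ)) := by rw [norm_schrH, one_mul]; exact hz2
  rw [spaceTimeH1, ← hsum (by positivity) (by positivity), ← hsum (by positivity) (by positivity)]
  refine add_le_add (add_le_add ?_ ?_) ?_
  · rw [funext (hw t ht0), ← hsum hD₀ zero_le_one]
    exact (eLpNorm_add_le (hmeas hUV) (hmev 0 (by norm_num) _) (by norm_num)).trans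
      (add_le_add ((hd₀ t ht1).trans (hofP hD₀)) (hofE zero_le_one hsz 0 (by norm_num)))
  · have e : deriv (fun x => ev 0 x (toH3 (prof U t) + schrH t (z t)) - ofProfile V t x)
        = ofProfile (Dx fun s y => U s y - V s y) t + fun x => ev 1 x (schrH t (z t)) := by
      rw [funext (hw t ht0)]
      exact funext fun x => ((hUV.hasDerivAt_ofProfile_x ht0 x).add
        (hasDerivAt_ev (by norm_num) _ x)).deriv
    rw [e, ← hsum hD₁ zero_le_one]
    exact (eLpNorm_add_le (hmeas hUV.Dx) (hmev 1 (by norm_num) _) (by norm_num)).trans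
      (add_le_add ((hd₁ t ht1).trans (hofP hD₁)) (hofE zero_le_one hsz 1 (by norm_num)))
  -- The time derivative of the correction is i∂_x² of it plus the transported right-hand side. The
  -- first is controlled by ‖z‖ in H³, the second by the bound on `rhs`.
  · have e : (fun x => deriv (fun τ => ev 0 x (toH3 (prof U τ) + schrH τ (z τ))
          - ofProfile V τ x) t)
        = ofProfile (Dt fun s y => U s y - V s y) t
          + ((fun x => ev 2 x (Complex.I • schrH t (z t))) + fun x => ev 0 x (schrH t
            (rhs β γ (fun t => toH3 (prof U t)) (fun t => toH3 (prof (Psi β γ U) t)) t (z t)))) := by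
      refine funext fun x => ?_
      refine (((hUV.hasDerivAt_ofProfile_t ht0 x).add
        (hasDerivAt_ev_schrH_curve hz1 x)).congr_of_eventuallyEq ?_).deriv.trans ?_
      · filter_upwards [eventually_gt_nhds ht0] with τ hτ using hw τ hτ x
      · simp only [Pi.add_apply, map_smul, smul_eq_mul]
    rw [e, ← hsum hD₂ (by positivity), ← hsum zero_le_one hC₃]
    refine (eLpNorm_add_le (hmeas hUV.Dt) ((hmev 2 (by norm_num) _).add (hmev 0 (by norm_num) _))
      (by norm_num)).trans (add_le_add ((hd₂ t ht1).trans (hofP hD₂)) ?_)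
    refine (eLpNorm_add_le (hmev 2 (by norm_num) _) (hmev 0 (by norm_num) _)
      (by norm_num)).trans (add_le_add ?_ ?_)
    · exact hofE zero_le_one (by rwa [norm_smul, Complex.norm_I, one_mul]) 2 (by norm_num)
    · exact hofE hC₃ (by rwa [norm_schrH]) 0 (by norm_num)

end

end NLS

end

theorem mainTheorem3 (β γ : ℝ) (a b : SchwartzMap ℝ ℝ) :
    -- the explicit (real-linear) inversion of the leading part of `L₀`
    (∀ k : ℕ, 1 ≤ k → ∀ (j : ℕ) (Y Z : ℝ → ℂ),
      (∀ y, Z y = (1 / (k : ℂ) ^ 2) *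
        ((-(β : ℂ) * (a y : ℂ) ^ 2 + Complex.I * k) * Y y
          + (β : ℂ) * (a y : ℂ) ^ 2 * (starRingEnd ℂ) (Y y))) →
      ∀ s : ℝ, 0 < s → ∀ y : ℝ,
        NLS.L0 β γ a b
            (fun σ η => NLS.osc β a b σ η * (Real.log σ : ℂ) ^ j / (σ : ℂ) ^ k * Z η) s y
          = NLS.osc β a b s y * (Real.log s : ℂ) ^ j / (s : ℂ) ^ (k + 1) * Y y
            + Complex.I * j *
              (NLS.osc β a b s y * (Real.log s : ℂ) ^ (j - 1) / (s : ℂ) ^ (k + 1)) * Z y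
            + NLS.osc β a b s y * (Real.log s : ℂ) ^ j / (s : ℂ) ^ (k + 2) *
              (-3 * (γ : ℂ) * (a y : ℂ) ^ 4 * Z y
                - 2 * (γ : ℂ) * (a y : ℂ) ^ 4 * (starRingEnd ℂ) (Z y))) ∧
    -- solvability for `L₀` modulo two orders
    (∀ k : ℕ, 1 ≤ k → ∀ ψ : ℝ → ℝ → ℂ, NLS.InS β a b (k + 1) ψ →
      ∃ f ψ' : ℝ → ℝ → ℂ, NLS.InS β a b k f ∧ NLS.InS β a b (k + 2) ψ' ∧
        ∀ s : ℝ, 0 < s → ∀ y : ℝ, NLS.L0 β γ a b f s y = ψ s y + ψ' s y) ∧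
    -- solvability for `Ψ'(V)` modulo two orders
    (∀ V : ℝ → ℝ → ℂ, NLS.InS β a b 1 (fun s y => V s y - NLS.V0 β a b s y) →
      ∀ k : ℕ, 1 ≤ k → ∀ ψ : ℝ → ℝ → ℂ, NLS.InS β a b (k + 1) ψ →
        ∃ f ψ' : ℝ → ℝ → ℂ, NLS.InS β a b k f ∧ NLS.InS β a b (k + 2) ψ' ∧
          ∀ s : ℝ, 0 < s → ∀ y : ℝ, NLS.dPsi β γ V f s y = ψ s y + ψ' s y) ∧
    -- the approximate solutions
    (∃ V : ℕ → ℝ → ℝ → ℂ, V 0 = NLS.V0 β a b ∧ ∀ n : ℕ,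
      NLS.InS β a b 1 (fun s y => V n s y - NLS.V0 β a b s y) ∧
      NLS.InS β a b (n + 1) (fun s y => V (n + 1) s y - V n s y) ∧
      NLS.InS β a b (n + 2) (NLS.Psi β γ (V n))) ∧
    -- exact solutions close to any approximate solution of order `N`
    (∀ N : ℕ, 1 ≤ N → ∀ V : ℝ → ℝ → ℂ,
      NLS.InS β a b 1 (fun s y => V s y - NLS.V0 β a b s y) →
      NLS.InS β a b (N + 2) (NLS.Psi β γ V) →
      ∃ (T C : ℝ) (v : ℝ → ℝ → ℂ), 1 ≤ T ∧ 0 ≤ C ∧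
        NLS.IsClassicalSolution β γ T v ∧
        ∀ t : ℝ, T < t →
          NLS.spaceTimeH1 (fun τ x => v τ x - NLS.ofProfile V τ x) t
            ≤ ENNReal.ofReal (C / t ^ N)) := by
  refine ⟨fun k hk j Y Z hZ s hs y => NLS.L0_osc_mul hk j Y Z hZ hs y, ?_, ?_, ?_, ?_⟩
  · intro k hk ψ hψ
    simpa only [NLS.inS_iff] using hψ.sym.exists_L0 (γ := γ) hk
  · intro V hV k hk ψ hψ
    simpa only [NLS.inS_iff] using NLS.Sym.exists_dPsi (γ := γ) hV.sym hk hψ.sym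
  · simpa only [NLS.inS_iff] using NLS.exists_approx β γ a b
  · intro N _ V hV hP
    exact NLS.exists_solution_near_approx hV.sym hP.sym
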